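/- Let $\widehat R_0$ be a complete discrete valuation ring with fraction field $F_0$ and normalized valuation $v$; fix a real number $\alpha>1$, let $|a|=\alpha^{-v(a)}$ (with $|0|=0$) be the corresponding norm on $F_0$, and put $|a|=\max_i|a_i|$ for $a\in F_0^n$. Assume that $\widehat R_0$ contains a subring $T$ which is also a complete discrete valuation ring, and that some $t\in T$ is a uniformizer of both $T$ and $\widehat R_0$. Let $F_1,F_2$ be subfields of $F_0$ containing $T$, and let $\mathcal V\subseteq F_1\cap\widehat R_0$ and $\mathcal W\subseteq F_2\cap\widehat R_0$ be $t$-adically complete $T$-submodules with $\mathcal V+\mathcal W=\widehat R_0$. (a) Let $n\ge 0$, and let $f:\mathbb A^n_{F_0}\times\mathbb A^n_{F_0}\dashrightarrow\mathbb A^n_{F_0}$ be an $F_0$-rational map that is defined on a Zariski open set $U\subseteq\mathbb A^n_{F_0}\times\mathbb A^n_{F_0}$ containing the origin $(0,0)$. Suppose that for $u\in F_0^n$ one has $f(u,0)=u$ whenever $(u,0)\in U$, and $f(0,u)=u$ whenever $(0,u)\in U$. Then there is a real number $\varepsilon>0$ such that for every $a\in F_0^n$ with $|a|\le\varepsilon$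 there exist $v\in\mathcal V^n$ and $w\in\mathcal W^n$ with $(v,w)\in U(F_0)$ and $f(v,w)=a$. (b) Let $F$ be a subfield of $F_1\cap F_2$ that contains $T$, and assume that $F_1$ is $t$-adically dense in $F_0$ (that is, dense for the norm $|\cdot|$). Let $G$ be a rational connected linear algebraic group over $F$, that is, a connected affine group scheme of finite type over $F$ which is an integral $F$-variety whose function field is $F$-isomorphic to $F(x_1,\dots,x_m)$ for some $m\ge 0$. Then for every $g\in G(F_0)$ there exist $g_1\in G(F_1)$ and $g_2\in G(F_2)$ such that $g=g_1g_2$ in $G(F_0)$. -/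

import Mathlib

noncomputable section

/-- The norm `|a| = α ^ (-v(a))` (with `|0| = 0`) on the fraction field `F₀` of a discrete valuation
ring `R₀`, where `v` is the normalized discrete valuation of `R₀`.  Mathlib's valuation at the
maximal ideal is multiplicative with values in `ℤᵐ⁰`, so its `WithZero.log` at `a ≠ 0`
is `-v(a)`. -/
def adicNorm (R₀ : Type*) {F₀ : Type*} [CommRing R₀] [IsDomain R₀] [IsDiscreteValuationRing R₀]
    [Field F₀] [Algebra R₀ F₀] [IsFractionRing R₀ F₀] (α : ℝ) (a : F₀) : ℝ :=
  open Classical in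
  if a = 0 then 0
  else α ^ (WithZero.log ((IsDiscreteValuationRing.maximalIdeal R₀).valuation F₀ a))

/-- The maximum norm on `F₀ ^ n` (equal to `0` for `n = 0`). -/
def adicVecNorm (R₀ : Type*) {F₀ : Type*} [CommRing R₀] [IsDomain R₀] [IsDiscreteValuationRing R₀]
    [Field F₀] [Algebra R₀ F₀] [IsFractionRing R₀ F₀] (α : ℝ) {n : ℕ} (a : Fin n → F₀) : ℝ :=
  ⨆ i, adicNorm R₀ α (a i)

/-- The subset `S` of `F₀` is dense for the metric `|x - y|` on `F₀`. -/
def IsAdicallyDense (R₀ : Type*) {F₀ : Type*} [CommRing R₀] [IsDomain R₀]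
    [IsDiscreteValuationRing R₀] [Field F₀] [Algebra R₀ F₀] [IsFractionRing R₀ F₀] (α : ℝ)
    (S : Set F₀) : Prop :=
  ∀ x : F₀, ∀ ε : ℝ, 0 < ε → ∃ y ∈ S, adicNorm R₀ α (x - y) < ε

/-- The setting of the additive decomposition: `R₀` is a complete discrete valuation ring with
fraction field `F₀`, `T ⊆ R₀` is a subring that is also a complete discrete valuation ring,
`t ∈ T` is a uniformizer of both, `F₁` and `F₂` are subfields of `F₀` that contain `T`, and
`V ⊆ F₁ ∩ R₀`, `W ⊆ F₂ ∩ R₀` are `t`-adically complete `T`-submodules with `V + W = R₀`. -/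
structure AdditiveDecomposition {R₀ F₀ : Type*} [CommRing R₀] [IsDomain R₀]
    [IsDiscreteValuationRing R₀] [Field F₀] [Algebra R₀ F₀] [IsFractionRing R₀ F₀]
    (T : Subring R₀) (t : T) (F₁ F₂ : Subfield F₀) (V W : Submodule T R₀) : Prop where
  complete_R₀ : IsAdicComplete (IsLocalRing.maximalIdeal R₀) R₀
  irreducible_R₀ : Irreducible (t : R₀)
  isDVR_T : IsDiscreteValuationRing T
  complete_T : IsAdicComplete (IsLocalRing.maximalIdeal T) T
  irreducible_T : Irreducible t
  T_le_F₁ : ∀ x ∈ T, algebraMap R₀ F₀ x ∈ F₁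
  T_le_F₂ : ∀ x ∈ T, algebraMap R₀ F₀ x ∈ F₂
  V_le_F₁ : ∀ x ∈ V, algebraMap R₀ F₀ x ∈ F₁
  W_le_F₂ : ∀ x ∈ W, algebraMap R₀ F₀ x ∈ F₂
  complete_V : IsAdicComplete (Ideal.span {t}) V
  complete_W : IsAdicComplete (Ideal.span {t}) W
  sup_eq_top : V ⊔ W = ⊤

/-- The rational function `φ` on the affine space with coordinates indexed by `σ` is regular on
the open subscheme `U`: at every point of `U` it can be written as `p / q` with `q` not vanishing
at that point. -/
def IsRegularOn {k σ : Type*} [Field k] (φ : FractionRing (MvPolynomial σ k))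
    (U : TopologicalSpace.Opens (PrimeSpectrum (MvPolynomial σ k))) : Prop :=
  ∀ P ∈ U, ∃ p q : MvPolynomial σ k, q ∉ P.asIdeal ∧
    φ = algebraMap (MvPolynomial σ k) (FractionRing (MvPolynomial σ k)) p /
      algebraMap (MvPolynomial σ k) (FractionRing (MvPolynomial σ k)) q

/-- The rational function `φ` is regular at the `k`-rational point `c` and its value there
is `y`. -/
def HasValueAt {k σ : Type*} [Field k] (φ : FractionRing (MvPolynomial σ k)) (c : σ → k)
    (y : k) : Prop :=
  ∃ p q : MvPolynomial σ k, MvPolynomial.eval c q ≠ 0 ∧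
    φ = algebraMap (MvPolynomial σ k) (FractionRing (MvPolynomial σ k)) p /
      algebraMap (MvPolynomial σ k) (FractionRing (MvPolynomial σ k)) q ∧
    y = MvPolynomial.eval c p / MvPolynomial.eval c q

/-- The affine `k`-variety with coordinate ring `A` is rational: it is integral, and it is
birational to an affine space, i.e. its function field is `k`-isomorphic to a rational function
field `k(x₁, …, xₙ)`. -/
def IsRationalVariety (k A : Type*) [Field k] [CommRing A] [Algebra k A] : Prop :=
  IsDomain A ∧ ∃ n : ℕ, Nonempty (FractionRing A ≃ₐ[k] FractionRing (MvPolynomial (Fin n) k))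

/-- The affine group scheme `G = Spec A` over `k`, for a commutative Hopf algebra `A`, is a rational
connected linear algebraic group.  (A rational variety is geometrically integral, so that `G` is
automatically smooth over `k`.) -/
structure IsRationalConnectedGroup (k A : Type*) [Field k] [CommRing A] [HopfAlgebra k A] :
    Prop where
  finiteType : Algebra.FiniteType k A
  connected : ConnectedSpace (PrimeSpectrum A)
  rational : IsRationalVariety k A

/-- The group `G(E)` of `E`-rational points of the affine group scheme `G = Spec A`: the `k`-algebra
homomorphisms `A → E`, multiplied through the comultiplication of `A` (convolution). -/
abbrev GroupPoints (k A E : Type*) [Field k] [CommRing A] [HopfAlgebra k A] [Field E]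
    [Algebra k E] : Type _ :=
  WithConv (A →ₐ[k] E)

/-- The map `G(E) → G(E')` induced by a homomorphism `E → E'` of field extensions of `k`. -/
def GroupPoints.map {k A E E' : Type*} [Field k] [CommRing A] [HopfAlgebra k A] [Field E]
    [Algebra k E] [Field E'] [Algebra k E'] (φ : E →ₐ[k] E') (g : GroupPoints k A E) :
    GroupPoints k A E' :=
  WithConv.toConv (φ.comp g.ofConv)

end

/-!
A map `f` as in (a) satisfies `f(v, w) = v + w + r(v, w)` with `r` vanishing on both axes `v = 0`
and `w = 0`, so every monomial of the numerator of `r` involves both groups of variables and has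
degree at least two. Rescaling by a high power `t ^ N` turns the equation `f = t ^ N a` into
`v + w + t g(v, w) = a` over `R₀`, where `g` is built from integral polynomials and so preserves
congruences. It is solved by successive approximation: an error `t ^ n d` is removed by splitting
`d` along `V + W = R₀`, which changes `t g` only modulo `t ^ (n + 1)`, and the corrections converge
in `V` and in `W`.

For (b), transport the group law to affine space through a birational chart. Near a rational point
`h₀` of the chart the map `(x, y) ↦ x h₀⁻¹ y` has the form required in (a), so points adically close
to `h₀` factor as `v h₀⁻¹ w` with `v` defined over `F₁` and `w` over `F₂`. An arbitrary `g` is moved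
close to `h₀`: rational points are Zariski dense, so some rational `h` puts `h₀ g⁻¹ h` in the chart,
and by density of `F₁` this point can be replaced by a nearby `y` over `F₁`. Then `y h⁻¹ g` is close
to `h₀`, and `g = (h y⁻¹ v h₀⁻¹) w`.
-/

open Filter Topology MvPolynomial

section SuccessiveApproximation

variable {T M N : Type*} [CommRing T] [AddCommGroup M] [Module T M] [AddCommGroup N] [Module T N]
  {t : T}

theorem sModEq_span_singleton_pow_iff {n : ℕ} {x y : M} :
    x ≡ y [SMOD (Ideal.span {t} ^ n • ⊤ : Submodule T M)] ↔ ∃ u, x = y + t ^ n • u := by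
  simp only [SModEq.sub_mem, Ideal.span_singleton_pow, Submodule.ideal_span_singleton_smul,
    Submodule.mem_smul_pointwise_iff_exists, Submodule.mem_top, true_and, eq_sub_iff_add_eq',
    eq_comm]

theorem isPrecomplete_span_singleton_iff :
    IsPrecomplete (Ideal.span {t}) M ↔ ∀ f : ℕ → M, (∀ n, ∃ u, f n = f (n + 1) + t ^ n • u) →
      ∃ L, ∀ n, ∃ u, f n = L + t ^ n • u := by
  simp only [isPrecomplete_iff, ← sModEq_span_singleton_pow_iff,
    ← AdicCompletion.isAdicCauchy_iff, AdicCompletion.IsAdicCauchy]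

theorem isPrecomplete_pi {ι : Type*} (h : IsPrecomplete (Ideal.span {t}) M) :
    IsPrecomplete (Ideal.span {t}) (ι → M) := by
  rw [isPrecomplete_span_singleton_iff] at h ⊢
  intro f hf
  choose u hu using hf
  choose L v hv using fun i => h (f · i) fun n => ⟨u n i, congrFun (hu n) i⟩
  exact ⟨L, fun n => ⟨fun i => v i n, funext fun i => hv i n⟩⟩

theorem isPrecomplete_prod (hM : IsPrecomplete (Ideal.span {t}) M)
    (hN : IsPrecomplete (Ideal.span {t}) N) : IsPrecomplete (Ideal.span {t}) (M × N) := by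
  rw [isPrecomplete_span_singleton_iff] at hM hN ⊢
  intro f hf
  choose u hu using hf
  obtain ⟨L, hL⟩ := hM (fun n => (f n).1) fun n => ⟨(u n).1, congrArg Prod.fst (hu n)⟩
  obtain ⟨L', hL'⟩ := hN (fun n => (f n).2) fun n => ⟨(u n).2, congrArg Prod.snd (hu n)⟩
  choose v hv using hL
  choose v' hv' using hL'
  exact ⟨(L, L'), fun n => ⟨(v n, v' n), Prod.ext (hv n) (hv' n)⟩⟩

theorem surjective_add_smul (hM : IsPrecomplete (Ideal.span {t}) M)
    (hN : IsHausdorff (Ideal.span {t}) N) {π : M →ₗ[T] N} (hπ : Function.Surjective π) {G : M → N}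
    (hG : ∀ n x u, ∃ w, G (x + t ^ n • u) = G x + t ^ n • w) :
    Function.Surjective fun x => π x + t • G x := by
  intro a
  have improve : ∀ n (x : {x // ∃ d, a = π x + t • G x + t ^ n • d}),
      ∃ y : {x // ∃ d, a = π x + t • G x + t ^ (n + 1) • d}, ∃ u, x.1 = y.1 + t ^ n • u := by
    rintro n ⟨x, d, hd⟩
    obtain ⟨u, rfl⟩ := hπ d
    obtain ⟨w, hw⟩ := hG n x u
    refine ⟨⟨x + t ^ n • u, -w, ?_⟩, -u, by module⟩
    rw [hw, hd, map_add, map_smul]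
    module
  choose next hnext using improve
  let approx (n : ℕ) : {x // ∃ d, a = π x + t • G x + t ^ n • d} :=
    Nat.rec ⟨0, a - (π 0 + t • G 0), by simp⟩ next n
  obtain ⟨x, hx⟩ := isPrecomplete_span_singleton_iff.1 hM (fun n => (approx n).1)
    fun n => hnext n (approx n)
  refine ⟨x, sub_eq_zero.1 <| hN.haus _ fun n => sModEq_span_singleton_pow_iff.2 ?_⟩
  obtain ⟨u, hu⟩ := hx n
  obtain ⟨w, hw⟩ := hG n x u
  obtain ⟨d, hd⟩ := (approx n).2
  refine ⟨-(π u + t • w + d), ?_⟩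
  rw [hd, hu, hw, map_add, map_smul]
  module

end SuccessiveApproximation

section CongruencePreserving

variable {R τ : Type*} [CommRing R]

/-- A function on `τ → R` that respects congruences modulo every element of `R`. -/
def IsCongruencePreserving (g : (τ → R) → R) : Prop :=
  ∀ d x u, d ∣ g (x + d • u) - g x

namespace IsCongruencePreserving

theorem eval (P : MvPolynomial τ R) : IsCongruencePreserving fun x => MvPolynomial.eval x P := by
  intro d x u
  simp only [← Ideal.mem_span_singleton, ← Ideal.Quotient.eq, ← MvPolynomial.eval₂_id,
    MvPolynomial.eval₂_comp_left]
  congr 1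
  funext i
  exact Ideal.Quotient.eq.2 (Ideal.mem_span_singleton.2 ⟨u i, by simp⟩)

theorem mul {g h : (τ → R) → R} (hg : IsCongruencePreserving g) (hh : IsCongruencePreserving h) :
    IsCongruencePreserving fun x => g x * h x := by
  intro d x u
  obtain ⟨a, ha⟩ := hg d x u
  obtain ⟨b, hb⟩ := hh d x u
  exact ⟨a * h (x + d • u) + g x * b, by linear_combination h (x + d • u) * ha + g x * hb⟩

theorem ringInverse {g : (τ → R) → R} (hg : IsCongruencePreserving g) (h : ∀ x, IsUnit (g x)) :
    IsCongruencePreserving fun x => Ring.inverse (g x) := by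
  intro d x u
  rw [Ring.inverse_sub_inverse (iff_of_true (h _) (h x))]
  exact ((dvd_sub_comm.1 (hg d x u)).mul_left _).mul_right _

end IsCongruencePreserving

end CongruencePreserving

section Adic

variable {R₀ F₀ : Type*} [CommRing R₀] [IsDomain R₀] [IsDiscreteValuationRing R₀]
  [Field F₀] [Algebra R₀ F₀] [IsFractionRing R₀ F₀] {ϖ : R₀}

theorem exists_eq_pow_mul_of_adicNorm_le (hϖ : Irreducible ϖ) {α : ℝ} (hα : 1 < α) {N : ℕ} {a : F₀}
    (ha : adicNorm R₀ α a ≤ α ^ (-(N : ℤ))) : ∃ r, a = algebraMap R₀ F₀ (ϖ ^ N * r) := by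
  rcases eq_or_ne a 0 with rfl | h0
  · exact ⟨0, by simp⟩
  have hπ : algebraMap R₀ F₀ ϖ ≠ 0 := by simpa using hϖ.ne_zero
  rw [adicNorm, if_neg h0, zpow_le_zpow_iff_right₀ hα] at ha
  have hvπ : (IsDiscreteValuationRing.maximalIdeal R₀).valuation F₀ (algebraMap R₀ F₀ ϖ) =
      WithZero.exp (-1) := by
    rw [IsDedekindDomain.HeightOneSpectrum.valuation_of_algebraMap]
    exact IsDedekindDomain.HeightOneSpectrum.intValuation_singleton _ hϖ.ne_zero
      hϖ.maximalIdeal_eq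
  obtain ⟨r, hr⟩ := IsDiscreteValuationRing.exists_lift_of_le_one (A := R₀)
    (x := (algebraMap R₀ F₀ ϖ ^ N)⁻¹ * a) (by
      rw [map_mul, map_inv₀, map_pow, hvπ, ← WithZero.exp_nsmul]
      refine (mul_le_mul_right (WithZero.le_exp_of_log_le ha) _).trans ?_
      rw [← WithZero.exp_neg, ← WithZero.exp_add]
      simp)
  exact ⟨r, by rw [map_mul, hr, map_pow]; field_simp⟩

theorem exists_eq_pow_smul_of_adicVecNorm_le (hϖ : Irreducible ϖ) {α : ℝ} (hα : 1 < α) {N n : ℕ}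
    {a : Fin n → F₀} (ha : adicVecNorm R₀ α a ≤ α ^ (-(N : ℤ))) :
    ∃ r : Fin n → R₀, a = algebraMap R₀ F₀ ∘ (ϖ ^ N • r) := by
  choose r hr using fun i => exists_eq_pow_mul_of_adicNorm_le (F₀ := F₀) hϖ hα
    ((le_ciSup (f := fun i => adicNorm R₀ α (a i)) (Set.finite_range _).bddAbove i).trans ha)
  exact ⟨r, funext hr⟩

theorem isHausdorff_pi_of_irreducible {T : Type*} [CommRing T] [Algebra T R₀] {t : T}
    (ht : Irreducible (algebraMap T R₀ t)) (ι : Type*) :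
    IsHausdorff (Ideal.span {t}) (ι → R₀) where
  haus' x hx := by
    funext i
    by_contra hi
    obtain ⟨n, hn⟩ := FiniteMultiplicity.of_not_isUnit ht.not_isUnit hi
    obtain ⟨u, hu⟩ := sModEq_span_singleton_pow_iff.1 (hx (n + 1))
    exact hn ⟨u i, by simp [hu, Algebra.smul_def]⟩

theorem eventually_exists_pow_mul_eq_algebraMap (hϖ : Irreducible ϖ) (a : F₀) :
    ∀ᶠ M in atTop, ∃ r, algebraMap R₀ F₀ ϖ ^ M * a = algebraMap R₀ F₀ r := by
  obtain ⟨x, y, hy, rfl⟩ := IsFractionRing.div_surjective (A := R₀) a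
  have hy0 : y ≠ 0 := nonZeroDivisors.ne_zero hy
  obtain ⟨K, u, rfl⟩ := IsDiscreteValuationRing.eq_unit_mul_pow_irreducible hy0 hϖ
  filter_upwards [eventually_ge_atTop K] with M hM
  obtain ⟨l, rfl⟩ := Nat.exists_eq_add_of_le hM
  refine ⟨ϖ ^ l * x * ↑u⁻¹, ?_⟩
  rw [mul_div_assoc', div_eq_iff (by simpa using hy0), ← map_pow, ← map_mul, ← map_mul]
  congr 1
  linear_combination -(ϖ ^ (K + l) * x) * u.inv_mul

end Adic

section Rescaling

variable {R₀ F₀ τ : Type*} [CommRing R₀] [IsDomain R₀] [IsDiscreteValuationRing R₀]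
  [Field F₀] [Algebra R₀ F₀] [IsFractionRing R₀ F₀] {ϖ : R₀}

theorem eventually_exists_rescaling_monomial (hϖ : Irreducible ϖ) {e : ℕ} {m : τ →₀ ℕ}
    (hm : e < m.degree) (a : F₀) : ∀ᶠ M in atTop, ∃ P' : MvPolynomial τ R₀, ∀ x : τ → R₀,
      eval (algebraMap R₀ F₀ ∘ (ϖ ^ M • x)) (monomial m a) =
        algebraMap R₀ F₀ (ϖ ^ (e * M + 1) * eval x P') := by
  filter_upwards [tendsto_sub_atTop_nat 1 |>.eventually
    (eventually_exists_pow_mul_eq_algebraMap hϖ a), eventually_ge_atTop 1] with M hM hM1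
  obtain ⟨r, hr⟩ := hM
  obtain ⟨l, hl⟩ : ∃ l, m.degree = e + 1 + l := Nat.exists_eq_add_of_le hm
  have hdeg : M * m.degree = (e * M + 1) + (M - 1) + M * l := by
    rw [hl]; zify [hM1]; ring
  refine ⟨monomial m (ϖ ^ (M * l) * r), fun x => ?_⟩
  have hscale : (m.prod fun i k => (ϖ ^ M • x) i ^ k) =
      ϖ ^ (M * m.degree) * m.prod fun i k => x i ^ k := by
    simp only [Finsupp.prod, Pi.smul_apply, smul_eq_mul, mul_pow, Finset.prod_mul_distrib,
      Finsupp.degree_apply, ← pow_mul, Finset.prod_pow_eq_pow_sum, ← Finset.mul_sum]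
  have hmap : (m.prod fun i k => (algebraMap R₀ F₀ ∘ (ϖ ^ M • x)) i ^ k) =
      algebraMap R₀ F₀ (m.prod fun i k => (ϖ ^ M • x) i ^ k) := by
    simp only [Finsupp.prod, map_prod, map_pow, Function.comp_apply]
  rw [eval_monomial, eval_monomial, hmap, hscale, hdeg]
  simp only [map_mul, map_pow, ← hr]
  ring

theorem eventually_exists_rescaling (hϖ : Irreducible ϖ) {e : ℕ} {P : MvPolynomial τ F₀}
    (hP : ∀ m ∈ P.support, e < m.degree) :
    ∀ᶠ M in atTop, ∃ P' : MvPolynomial τ R₀, ∀ x : τ → R₀,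
      eval (algebraMap R₀ F₀ ∘ (ϖ ^ M • x)) P =
        algebraMap R₀ F₀ (ϖ ^ (e * M + 1) * eval x P') := by
  filter_upwards [(Finset.eventually_all P.support).2 fun m hm =>
    eventually_exists_rescaling_monomial hϖ (hP m hm) (P.coeff m)] with M hM
  choose! P' hP' using hM
  refine ⟨∑ m ∈ P.support, P' m, fun x => ?_⟩
  conv_lhs => rw [P.as_sum]
  rw [map_sum, map_sum, Finset.mul_sum, map_sum]
  exact Finset.sum_congr rfl fun m hm => hP' m hm x

theorem isUnit_one_add_mul (hϖ : Irreducible ϖ) (r : R₀) : IsUnit (1 + ϖ * r) := by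
  have h : -(ϖ * r) ∈ nonunits R₀ :=
    neg_mem (Ideal.mul_mem_right r (IsLocalRing.maximalIdeal R₀) hϖ.not_isUnit)
  simpa using IsLocalRing.isUnit_one_sub_self_of_mem_nonunits _ h

theorem eventually_exists_unit_rescaling (hϖ : Irreducible ϖ) {q : MvPolynomial τ F₀}
    (hq : eval 0 q ≠ 0) : ∀ᶠ M in atTop, ∃ Q : MvPolynomial τ R₀, ∀ x : τ → R₀,
      IsUnit (eval x Q) ∧
        eval (algebraMap R₀ F₀ ∘ (ϖ ^ M • x)) q = eval 0 q * algebraMap R₀ F₀ (eval x Q) := by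
  have hdeg : ∀ m ∈ (C (eval 0 q)⁻¹ * q - 1).support, 0 < m.degree := by
    intro m hm
    rw [pos_iff_ne_zero, Ne, Finsupp.degree_eq_zero_iff]
    rintro rfl
    rw [eval_zero, constantCoeff_eq] at hm hq
    simp [hq] at hm
  filter_upwards [eventually_exists_rescaling hϖ hdeg] with M ⟨Q, hQ⟩
  refine ⟨1 + C ϖ * Q, fun x => ⟨?_, ?_⟩⟩
  · simpa using isUnit_one_add_mul hϖ (eval x Q)
  · have h := hQ x
    simp only [map_sub, map_mul, eval_C, map_one, zero_mul, zero_add, pow_one] at h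
    simp only [map_add, map_mul, map_one, eval_C, ← h]
    field_simp
    ring

theorem eventually_exists_rescaling_div (hϖ : Irreducible ϖ) {e : ℕ} {p q : MvPolynomial τ F₀}
    (hp : ∀ m ∈ p.support, e < m.degree) (hq : eval 0 q ≠ 0) :
    ∀ᶠ M in atTop, ∃ g : (τ → R₀) → R₀, IsCongruencePreserving g ∧ ∀ x,
      eval (algebraMap R₀ F₀ ∘ (ϖ ^ M • x)) q ≠ 0 ∧
      eval (algebraMap R₀ F₀ ∘ (ϖ ^ M • x)) p / eval (algebraMap R₀ F₀ ∘ (ϖ ^ M • x)) q =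
        algebraMap R₀ F₀ (ϖ ^ (e * M + 1) * g x) := by
  have hp' : ∀ m ∈ (C (eval 0 q)⁻¹ * p).support, e < m.degree := fun m hm => hp m <| by
    rw [mem_support_iff, coeff_C_mul] at hm
    exact mem_support_iff.2 (right_ne_zero_of_mul hm)
  filter_upwards [eventually_exists_rescaling hϖ hp', eventually_exists_unit_rescaling hϖ hq]
    with M ⟨P, hP⟩ ⟨Q, hQ⟩
  refine ⟨_, (IsCongruencePreserving.eval P).mul
    ((IsCongruencePreserving.eval Q).ringInverse fun x => (hQ x).1), fun x => ?_⟩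
  obtain ⟨⟨u, hu⟩, hqx⟩ := hQ x
  have hpx := hP x
  have hu0 : algebraMap R₀ F₀ u ≠ 0 := by simp
  rw [map_mul, eval_C, inv_mul_eq_iff_eq_mul₀ hq, ← u.mul_inv_cancel_right (eval x P)] at hpx
  rw [hqx, ← hu, Ring.inverse_unit, hpx]
  refine ⟨mul_ne_zero hq hu0, ?_⟩
  simp only [map_mul]
  field_simp

end Rescaling

section ZariskiNhds

variable {k τ : Type*} [Field k]

/-- The neighbourhood filter of a rational point `c` of affine space for the Zariski topology on
rational points. -/
noncomputable def zariskiNhds (c : τ → k) : Filter (τ → k) :=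
  comap pointToPoint (𝓝 (pointToPoint c : PrimeSpectrum (MvPolynomial τ k)))

theorem eventually_zariskiNhds_iff {c : τ → k} {p : (τ → k) → Prop} :
    (∀ᶠ x in zariskiNhds c, p x) ↔ ∃ s, eval c s ≠ 0 ∧ ∀ x, eval x s ≠ 0 → p x := by
  have hmem (x : τ → k) (s : MvPolynomial τ k) :
      pointToPoint x ∈ PrimeSpectrum.basicOpen s ↔ eval x s ≠ 0 := by
    simp [pointToPoint]
  rw [zariskiNhds, ((PrimeSpectrum.isTopologicalBasis_basic_opens.nhds_hasBasis).comap pointToPoint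
    ).eventually_iff]
  simp only [Set.mem_range, Set.mem_preimage]
  constructor
  · rintro ⟨_, ⟨⟨s, rfl⟩, hs⟩, h⟩
    exact ⟨s, (hmem c s).1 hs, fun x hx => h ((hmem x s).2 hx)⟩
  · rintro ⟨s, hs, h⟩
    exact ⟨_, ⟨⟨s, rfl⟩, (hmem c s).2 hs⟩, fun x hx => h x ((hmem x s).1 hx)⟩

theorem eventually_zariskiNhds_eval_ne_zero {c : τ → k} {s : MvPolynomial τ k}
    (hs : eval c s ≠ 0) : ∀ᶠ x in zariskiNhds c, eval x s ≠ 0 :=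
  eventually_zariskiNhds_iff.2 ⟨s, hs, fun _ => id⟩

theorem self_of_zariskiNhds {c : τ → k} {p : (τ → k) → Prop} (h : ∀ᶠ x in zariskiNhds c, p x) :
    p c :=
  let ⟨_, hs, h⟩ := eventually_zariskiNhds_iff.1 h
  h c hs

open Classical in
theorem sub_bind₁_mem_span_X (S : Set τ) (p : MvPolynomial τ k) :
    p - bind₁ (fun i => if i ∈ S then 0 else X i) p ∈
      Ideal.span (X '' S : Set (MvPolynomial τ k)) := by
  set I := Ideal.span (X '' S : Set (MvPolynomial τ k))
  rw [← Ideal.Quotient.eq_zero_iff_mem, map_sub, sub_eq_zero]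
  suffices Ideal.Quotient.mkₐ k I = (Ideal.Quotient.mkₐ k I).comp (bind₁ _) from
    DFunLike.congr_fun this p
  refine algHom_ext fun i => ?_
  by_cases hi : i ∈ S
  · have hX : X i ∈ I := Ideal.subset_span ⟨i, hi, rfl⟩
    simp [hi, Ideal.Quotient.eq_zero_iff_mem.2 hX]
  · simp [hi]

theorem mem_span_X_of_eventually_eval_eq_zero [Infinite k] {S : Set τ} {r : MvPolynomial τ k}
    (hr : ∀ᶠ c in zariskiNhds 0, (∀ i ∈ S, c i = 0) → eval c r = 0) :
    r ∈ Ideal.span (X '' S : Set (MvPolynomial τ k)) := by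
  classical
  obtain ⟨s, hs, h⟩ := eventually_zariskiNhds_iff.1 hr
  let ρ : MvPolynomial τ k →ₐ[k] MvPolynomial τ k := bind₁ fun i => if i ∈ S then 0 else X i
  have heval (x : τ → k) (p : MvPolynomial τ k) :
      eval x (ρ p) = eval (fun i => if i ∈ S then 0 else x i) p := by
    rw [← coe_aeval_eq_eval, RingHom.coe_coe, aeval_bind₁, ← coe_aeval_eq_eval, RingHom.coe_coe]
    simp only [apply_ite (aeval x), map_zero, aeval_X]
  have hρs : ρ s ≠ 0 := by
    intro h0
    have := heval 0 s
    simp only [h0, map_zero, Pi.zero_apply, ite_self] at this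
    exact hs this.symm
  have hρr : ρ r = 0 := by
    refine (mul_eq_zero.1 (MvPolynomial.funext fun x => ?_)).resolve_left hρs
    rw [map_mul, map_zero, heval, heval]
    by_cases hx : eval (fun i => if i ∈ S then 0 else x i) s = 0
    · rw [hx, zero_mul]
    · rw [h _ hx fun i hi => if_pos hi, mul_zero]
  simpa [ρ, hρr] using sub_bind₁_mem_span_X S r

theorem algebraMap_ne_zero_of_eval_ne_zero {c : τ → k} {q : MvPolynomial τ k} (hq : eval c q ≠ 0) :
    algebraMap _ (FractionRing (MvPolynomial τ k)) q ≠ 0 := by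
  rw [Ne, FaithfulSMul.algebraMap_eq_zero_iff]
  rintro rfl
  exact hq (map_zero _)

end ZariskiNhds

namespace HasValueAt

variable {k τ : Type*} [Field k] {φ ψ : FractionRing (MvPolynomial τ k)} {c : τ → k} {y z : k}

protected theorem polynomial (p : MvPolynomial τ k) (c : τ → k) :
    HasValueAt (algebraMap _ _ p) c (eval c p) :=
  ⟨p, 1, by simp, by simp, by simp⟩

protected theorem const (y : k) (c : τ → k) : HasValueAt (algebraMap _ _ y) c y := by
  simpa [IsScalarTower.algebraMap_apply k (MvPolynomial τ k) (FractionRing _)] using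
    HasValueAt.polynomial (C y) c

theorem add (hφ : HasValueAt φ c y) (hψ : HasValueAt ψ c z) : HasValueAt (φ + ψ) c (y + z) := by
  obtain ⟨p, q, hq, rfl, rfl⟩ := hφ
  obtain ⟨r, s, hs, rfl, rfl⟩ := hψ
  refine ⟨p * s + q * r, q * s, by simp [hq, hs], ?_, ?_⟩
  · simp [div_add_div _ _ (algebraMap_ne_zero_of_eval_ne_zero hq)
      (algebraMap_ne_zero_of_eval_ne_zero hs)]
  · simp [div_add_div _ _ hq hs]

theorem mul (hφ : HasValueAt φ c y) (hψ : HasValueAt ψ c z) : HasValueAt (φ * ψ) c (y * z) := by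
  obtain ⟨p, q, hq, rfl, rfl⟩ := hφ
  obtain ⟨r, s, hs, rfl, rfl⟩ := hψ
  exact ⟨p * r, q * s, by simp [hq, hs], by simp [div_mul_div_comm], by simp [div_mul_div_comm]⟩

theorem inv (hφ : HasValueAt φ c y) (hy : y ≠ 0) : HasValueAt φ⁻¹ c y⁻¹ := by
  obtain ⟨p, q, -, rfl, rfl⟩ := hφ
  exact ⟨q, p, fun h => hy (by simp [h]), by simp, by simp⟩

theorem sub_const (hφ : HasValueAt φ c y) (z : k) :
    HasValueAt (φ - algebraMap _ _ z) c (y - z) := by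
  simpa [sub_eq_add_neg] using hφ.add (HasValueAt.const (-z) c)

theorem eval_eq_mul {p q : MvPolynomial τ k}
    (h : HasValueAt (algebraMap _ _ p / algebraMap _ _ q) c y) (hq : q ≠ 0) :
    eval c p = y * eval c q := by
  obtain ⟨p', q', hq', h, rfl⟩ := h
  rw [div_eq_div_iff (by simpa using hq) (algebraMap_ne_zero_of_eval_ne_zero hq'), ← map_mul,
    ← map_mul] at h
  have := congrArg (eval c) (IsFractionRing.injective _ (FractionRing (MvPolynomial τ k)) h)
  rw [map_mul, map_mul] at this
  field_simp
  linear_combination this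

theorem unique (hy : HasValueAt φ c y) (hz : HasValueAt φ c z) : y = z := by
  obtain ⟨p, q, hq, rfl, rfl⟩ := hy
  rw [hz.eval_eq_mul (by rintro rfl; simp at hq), mul_div_cancel_right₀ _ hq]

theorem ne_zero (h : HasValueAt φ c y) (hy : y ≠ 0) : φ ≠ 0 := by
  rintro rfl
  exact hy (h.unique (by simpa using HasValueAt.const 0 c))

theorem eventually_ne_zero (h : HasValueAt φ c y) (hy : y ≠ 0) :
    ∀ᶠ x in zariskiNhds c, ∃ z ≠ 0, HasValueAt φ x z := by
  obtain ⟨p, q, hq, rfl, rfl⟩ := h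
  have hp : eval c p ≠ 0 := fun h => hy (by simp [h])
  filter_upwards [eventually_zariskiNhds_eval_ne_zero hp, eventually_zariskiNhds_eval_ne_zero hq]
    with x hpx hqx
  exact ⟨_, div_ne_zero hpx hqx, p, q, hqx, rfl, rfl⟩

end HasValueAt

section AdicNhds

variable {R₀ F₀ τ : Type*} [CommRing R₀] [IsDomain R₀] [IsDiscreteValuationRing R₀]
  [Field F₀] [Algebra R₀ F₀] [IsFractionRing R₀ F₀] {ϖ : R₀}

theorem exists_eval_eq_eval_add {k : Type*} [CommSemiring k] (c : τ → k) (p : MvPolynomial τ k) :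
    ∃ p' : MvPolynomial τ k, ∀ x, eval x p' = eval (c + x) p := by
  refine ⟨bind₁ (fun i => C (c i) + X i) p, fun x => ?_⟩
  rw [← coe_aeval_eq_eval, RingHom.coe_coe, aeval_bind₁, ← coe_aeval_eq_eval, RingHom.coe_coe]
  congr 2
  funext i
  simp

theorem eventually_adic_of_zariskiNhds (hϖ : Irreducible ϖ) {c : τ → F₀} {p : (τ → F₀) → Prop}
    (h : ∀ᶠ x in zariskiNhds c, p x) :
    ∀ᶠ M in atTop, ∀ x : τ → R₀, p (c + algebraMap R₀ F₀ ∘ (ϖ ^ M • x)) := by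
  obtain ⟨s, hs, h⟩ := eventually_zariskiNhds_iff.1 h
  obtain ⟨s', hs'⟩ := exists_eval_eq_eval_add c s
  have hs'0 : eval 0 s' ≠ 0 := by rwa [hs', add_zero]
  filter_upwards [eventually_exists_unit_rescaling hϖ hs'0] with M ⟨Q, hQ⟩ x
  refine h _ ?_
  rw [← hs', (hQ x).2]
  exact mul_ne_zero hs'0 (by simpa using (hQ x).1.ne_zero)

theorem HasValueAt.eventually_adic (hϖ : Irreducible ϖ) {φ : FractionRing (MvPolynomial τ F₀)}
    {c : τ → F₀} {y : F₀} (h : HasValueAt φ c y) (N : ℕ) :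
    ∀ᶠ M in atTop, ∀ x : τ → R₀, ∃ r,
      HasValueAt φ (c + algebraMap R₀ F₀ ∘ (ϖ ^ M • x)) (y + algebraMap R₀ F₀ (ϖ ^ N * r)) := by
  obtain ⟨p, q, hq, rfl, rfl⟩ := h
  set y := eval c p / eval c q with hy
  have hϖ0 : algebraMap R₀ F₀ ϖ ^ N ≠ 0 := pow_ne_zero _ (by simpa using hϖ.ne_zero)
  obtain ⟨p', hp'⟩ := exists_eval_eq_eval_add c (C (algebraMap R₀ F₀ ϖ ^ N)⁻¹ * (p - C y * q))
  obtain ⟨q', hq'⟩ := exists_eval_eq_eval_add c q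
  have hp'0 : ∀ m ∈ p'.support, 0 < m.degree := by
    intro m hm
    rw [pos_iff_ne_zero, Ne, Finsupp.degree_eq_zero_iff]
    rintro rfl
    rw [mem_support_iff, ← constantCoeff_eq, ← eval_zero, hp'] at hm
    simp [hy, hq] at hm
  have hq'0 : eval 0 q' ≠ 0 := by rwa [hq', add_zero]
  filter_upwards [eventually_exists_rescaling_div hϖ hp'0 hq'0] with M ⟨g, _, hg⟩ x
  obtain ⟨hqx, hgx⟩ := hg x
  rw [hq'] at hqx hgx
  refine ⟨ϖ * g x, p, q, hqx, rfl, ?_⟩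
  rw [hp', zero_mul, zero_add, pow_one] at hgx
  rw [map_mul, ← hgx, eq_div_iff hqx]
  simp only [map_sub, map_mul, map_pow, eval_C]
  field_simp
  ring

end AdicNhds

section SmallVectors

theorem one_lt_degree_of_eventually_eval_eq_zero {k ι : Type*} [Field k] [Infinite k]
    {r : MvPolynomial (ι ⊕ ι) k}
    (hr : ∀ᶠ c in zariskiNhds 0, c ∘ Sum.inl = 0 ∨ c ∘ Sum.inr = 0 → eval c r = 0)
    {m : ι ⊕ ι →₀ ℕ} (hm : m ∈ r.support) : 1 < m.degree := by
  classical
  have hl : r ∈ Ideal.span (X '' Set.range Sum.inl) :=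
    mem_span_X_of_eventually_eval_eq_zero <|
      hr.mono fun c h hc => h (.inl (funext fun i => hc _ ⟨i, rfl⟩))
  have hr : r ∈ Ideal.span (X '' Set.range Sum.inr) :=
    mem_span_X_of_eventually_eval_eq_zero <|
      hr.mono fun c h hc => h (.inr (funext fun i => hc _ ⟨i, rfl⟩))
  obtain ⟨_, ⟨i, rfl⟩, hi⟩ := mem_ideal_span_X_image.1 hl m hm
  obtain ⟨_, ⟨j, rfl⟩, hj⟩ := mem_ideal_span_X_image.1 hr m hm
  have hsub : ({Sum.inl i, Sum.inr j} : Finset (ι ⊕ ι)) ⊆ m.support := by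
    simp [Finset.insert_subset_iff, hi, hj]
  have := Finset.sum_le_sum_of_subset (f := m) hsub
  rw [Finset.sum_pair Sum.inl_ne_inr] at this
  rw [Finsupp.degree_apply]
  omega

variable {R₀ F₀ ι : Type*} [CommRing R₀] [IsDomain R₀] [IsDiscreteValuationRing R₀]
  [Field F₀] [Algebra R₀ F₀] [IsFractionRing R₀ F₀]

theorem eventually_hasValueAt_add_add_mul {ϖ : R₀} (hϖ : Irreducible ϖ)
    {f : FractionRing (MvPolynomial (ι ⊕ ι) F₀)} {i : ι}
    (hf : ∀ᶠ c in zariskiNhds 0, c ∘ Sum.inl = 0 ∨ c ∘ Sum.inr = 0 →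
      HasValueAt f c (c (.inl i) + c (.inr i))) :
    ∀ᶠ M in atTop, ∃ g : (ι ⊕ ι → R₀) → R₀, IsCongruencePreserving g ∧ ∀ x,
      HasValueAt f (algebraMap R₀ F₀ ∘ (ϖ ^ M • x))
        (algebraMap R₀ F₀ (ϖ ^ M * (x (.inl i) + x (.inr i) + ϖ * g x))) := by
  have : Infinite R₀ := .of_injective _ (pow_injective_of_not_isUnit hϖ.not_isUnit hϖ.ne_zero)
  have : Infinite F₀ := .of_injective _ (IsFractionRing.injective R₀ F₀)
  obtain ⟨p, q, hq, rfl, -⟩ := self_of_zariskiNhds hf (.inl rfl)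
  have hq0 : q ≠ 0 := by rintro rfl; simp at hq
  have hr : ∀ m ∈ (p - (X (Sum.inl i) + X (Sum.inr i)) * q).support, 1 < m.degree := by
    refine fun m => one_lt_degree_of_eventually_eval_eq_zero (hf.mono fun c h hc => ?_)
    simp [(h hc).eval_eq_mul hq0]
  filter_upwards [eventually_exists_rescaling_div hϖ hr hq] with M ⟨g, hg, hgx⟩
  refine ⟨g, hg, fun x => ⟨p, q, (hgx x).1, rfl, ?_⟩⟩
  obtain ⟨hqx, hx⟩ := hgx x
  rw [div_eq_iff hqx] at hx
  rw [eq_div_iff hqx]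
  simp only [map_sub, map_add, map_mul, map_pow, eval_X, Function.comp_apply, Pi.smul_apply,
    smul_eq_mul] at hx ⊢
  linear_combination -hx

theorem surjective_add_add_smul {T : Type*} [CommRing T] [Algebra T R₀] {t : T}
    (ht : Irreducible (algebraMap T R₀ t)) {V W : Submodule T R₀}
    (hV : IsPrecomplete (Ideal.span {t}) V) (hW : IsPrecomplete (Ideal.span {t}) W)
    (hVW : V ⊔ W = ⊤) {g : ι → (ι ⊕ ι → R₀) → R₀} (hg : ∀ i, IsCongruencePreserving (g i))
    (a : ι → R₀) : ∃ x : ι ⊕ ι → R₀, (∀ i, x (.inl i) ∈ V) ∧ (∀ i, x (.inr i) ∈ W) ∧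
      ∀ i, x (.inl i) + x (.inr i) + algebraMap T R₀ t * g i x = a i := by
  let point (x : (ι → V) × (ι → W)) : ι ⊕ ι → R₀ := Sum.elim (fun i => x.1 i) fun i => x.2 i
  let π : (ι → V) × (ι → W) →ₗ[T] ι → R₀ :=
    (V.subtype.compLeft ι).coprod (W.subtype.compLeft ι)
  have hπ : Function.Surjective π := by
    intro b
    choose v hv w hw h using fun i => Submodule.mem_sup.1 (hVW ▸ Submodule.mem_top (x := b i))
    exact ⟨(fun i => ⟨v i, hv i⟩, fun i => ⟨w i, hw i⟩), funext h⟩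
  have hG (n : ℕ) (x u : (ι → V) × (ι → W)) : ∃ w : ι → R₀,
      (fun i => g i (point (x + t ^ n • u))) = (fun i => g i (point x)) + t ^ n • w := by
    have hpoint : point (x + t ^ n • u) = point x + algebraMap T R₀ t ^ n • point u := by
      funext i
      cases i <;> simp [point, Algebra.smul_def]
    choose w hw using fun i => hg i (algebraMap T R₀ t ^ n) (point x) (point u)
    exact ⟨w, funext fun i => by simp [hpoint, Algebra.smul_def, ← hw]⟩
  obtain ⟨x, hx⟩ := surjective_add_smul (isPrecomplete_prod (isPrecomplete_pi hV)
    (isPrecomplete_pi hW)) (isHausdorff_pi_of_irreducible ht ι) hπ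
    (G := fun x i => g i (point x)) hG a
  refine ⟨point x, fun i => (x.1 i).2, fun i => (x.2 i).2, fun i => ?_⟩
  simpa [π, point, Algebra.smul_def] using congrFun hx i

theorem exists_forall_exists_hasValueAt [Finite ι] {T : Type*} [CommRing T] [Algebra T R₀] {t : T}
    (ht : Irreducible (algebraMap T R₀ t)) {V W : Submodule T R₀}
    (hV : IsPrecomplete (Ideal.span {t}) V) (hW : IsPrecomplete (Ideal.span {t}) W)
    (hVW : V ⊔ W = ⊤) {f : ι → FractionRing (MvPolynomial (ι ⊕ ι) F₀)}
    (hf : ∀ᶠ c in zariskiNhds 0, c ∘ Sum.inl = 0 ∨ c ∘ Sum.inr = 0 →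
      ∀ i, HasValueAt (f i) c (c (.inl i) + c (.inr i)))
    {p : (ι ⊕ ι → F₀) → Prop} (hp : ∀ᶠ c in zariskiNhds 0, p c) :
    ∃ N : ℕ, ∀ a : ι → R₀, ∃ x : ι ⊕ ι → R₀, (∀ i, x (.inl i) ∈ V) ∧ (∀ i, x (.inr i) ∈ W) ∧
      p (algebraMap R₀ F₀ ∘ x) ∧
      ∀ i, HasValueAt (f i) (algebraMap R₀ F₀ ∘ x)
        (algebraMap R₀ F₀ (algebraMap T R₀ t ^ N * a i)) := by
  obtain ⟨N, hpN, hfN⟩ := ((eventually_adic_of_zariskiNhds ht hp).and <| eventually_all.2 fun i =>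
    eventually_hasValueAt_add_add_mul ht (hf.mono fun c h hc => h hc i)).exists
  choose g hg hfg using hfN
  refine ⟨N, fun a => ?_⟩
  obtain ⟨x, hxV, hxW, hx⟩ := surjective_add_add_smul ht hV hW hVW hg a
  refine ⟨algebraMap T R₀ t ^ N • x, fun i => ?_, fun i => ?_, by simpa using hpN x,
    fun i => hx i ▸ hfg i x⟩
  · simpa [Algebra.smul_def] using V.smul_mem (t ^ N) (hxV i)
  · simpa [Algebra.smul_def] using W.smul_mem (t ^ N) (hxW i)

end SmallVectors

section Specialization

variable {k E τ : Type*} [Field k] [Field E] [Algebra k E]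

/-- A point `Γ` of `Spec B` over the function field of affine space over `E` is a rational map from
affine space to `Spec B`; this says that it is regular at `c`, with value `g`. -/
def SpecializesAt {B : Type*} [CommRing B] [Algebra k B] (c : τ → E)
    (Γ : B →ₐ[k] FractionRing (MvPolynomial τ E)) (g : B →ₐ[k] E) : Prop :=
  ∀ b, HasValueAt (Γ b) c (g b)

namespace SpecializesAt

variable {B : Type*} [CommRing B] [Algebra k B] {c : τ → E}
  {Γ Δ : B →ₐ[k] FractionRing (MvPolynomial τ E)} {g h : B →ₐ[k] E}

protected theorem const (g : B →ₐ[k] E) (c : τ → E) :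
    SpecializesAt c ((IsScalarTower.toAlgHom k E (FractionRing (MvPolynomial τ E))).comp g) g :=
  fun b => HasValueAt.const (g b) c

theorem of_mvPolynomial {σ : Type*} {Γ : MvPolynomial σ k →ₐ[k] FractionRing (MvPolynomial τ E)}
    {g : MvPolynomial σ k →ₐ[k] E} (h : ∀ i, HasValueAt (Γ (X i)) c (g (X i))) :
    SpecializesAt c Γ g := by
  intro p
  induction p using MvPolynomial.induction_on with
  | C a =>
    simpa [← algebraMap_eq, ← IsScalarTower.algebraMap_apply] using
      HasValueAt.const (algebraMap k E a) c
  | add p q hp hq => simpa only [map_add] using hp.add hq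
  | mul_X p i hp => simpa only [map_mul] using hp.mul (h i)

theorem of_isLocalization {A : Type*} [CommRing A] [Algebra k A] [Algebra A B]
    [IsScalarTower k A B] (M : Submonoid A) [IsLocalization M B]
    (h : SpecializesAt c (Γ.comp (IsScalarTower.toAlgHom k A B))
      (g.comp (IsScalarTower.toAlgHom k A B))) : SpecializesAt c Γ g := by
  intro b
  obtain ⟨⟨a, s⟩, hb⟩ := IsLocalization.surj M b
  have hs : g (algebraMap A B s) ≠ 0 := ((IsLocalization.map_units B s).map g).ne_zero
  have hΓs : Γ (algebraMap A B s) ≠ 0 := ((IsLocalization.map_units B s).map Γ).ne_zero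
  rw [eq_div_of_mul_eq hs ((map_mul g _ _).symm.trans (congrArg g hb)),
    eq_div_of_mul_eq hΓs ((map_mul Γ _ _).symm.trans (congrArg Γ hb)), div_eq_mul_inv,
    div_eq_mul_inv]
  exact (h a).mul ((h s).inv hs)

open TensorProduct in
theorem convMul {A : Type*} [CommRing A] [HopfAlgebra k A]
    {Γ Δ : GroupPoints k A (FractionRing (MvPolynomial τ E))} {g h : GroupPoints k A E}
    (hg : SpecializesAt c Γ.ofConv g.ofConv) (hh : SpecializesAt c Δ.ofConv h.ofConv) :
    SpecializesAt c (Γ * Δ).ofConv (g * h).ofConv := by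
  intro a
  have key (z : A ⊗[k] A) : HasValueAt
      (Algebra.TensorProduct.lmul' k (Algebra.TensorProduct.map Γ.ofConv Δ.ofConv z)) c
      (Algebra.TensorProduct.lmul' k (Algebra.TensorProduct.map g.ofConv h.ofConv z)) := by
    induction z with
    | zero => simpa using HasValueAt.const 0 c
    | add x y hx hy => simpa only [map_add] using hx.add hy
    | tmul x y => simpa using (hg x).mul (hh y)
  exact key (Coalgebra.comul a)

end SpecializesAt

end Specialization

section Birational

variable {k A B K : Type*} [Field k] [Field K] [Algebra k K]
  [CommRing A] [IsDomain A] [Algebra k A] [Algebra A K] [IsScalarTower k A K] [IsFractionRing A K]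
  [CommRing B] [Algebra k B] [Algebra B K] [IsScalarTower k B K]

variable (k K) in
/-- The localization `A[1/a]` as a `k`-subalgebra of the fraction field `K` of `A`. -/
noncomputable def awaySubalgebra {a : A} (ha : a ≠ 0) : Subalgebra k K :=
  (Localization.subalgebra.ofField K (Submonoid.powers a)
    (powers_le_nonZeroDivisors_of_noZeroDivisors ha)).restrictScalars k

theorem mem_awaySubalgebra {a : A} {ha : a ≠ 0} {x : K} : x ∈ awaySubalgebra k K ha ↔
    ∃ (c : A) (n : ℕ), x = algebraMap A K c * (algebraMap A K a ^ n)⁻¹ := by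
  constructor
  · rintro ⟨c, _, ⟨n, rfl⟩, rfl⟩
    exact ⟨c, n, by rw [map_pow]⟩
  · rintro ⟨c, n, rfl⟩
    exact ⟨c, _, ⟨n, rfl⟩, by rw [map_pow]⟩

theorem range_le_awaySubalgebra {a : A} (ha : a ≠ 0) :
    (IsScalarTower.toAlgHom k A K).range ≤ awaySubalgebra k K ha := by
  rintro _ ⟨x, rfl⟩
  exact mem_awaySubalgebra.2 ⟨x, 0, by simp⟩

theorem inv_mem_awaySubalgebra {a : A} (ha : a ≠ 0) :
    (algebraMap A K a)⁻¹ ∈ awaySubalgebra k K ha :=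
  mem_awaySubalgebra.2 ⟨1, 1, by simp⟩

theorem awaySubalgebra_le {a : A} {ha : a ≠ 0} {L : Subalgebra k K}
    (hA : (IsScalarTower.toAlgHom k A K).range ≤ L) (haL : (algebraMap A K a)⁻¹ ∈ L) :
    awaySubalgebra k K ha ≤ L := by
  intro x hx
  obtain ⟨c, n, rfl⟩ := mem_awaySubalgebra.1 hx
  rw [← inv_pow]
  exact L.mul_mem (hA ⟨c, rfl⟩) (L.pow_mem haL n)

/-- The subalgebra `A[1/a]` of the fraction field is a localization of `A` away from `a`. -/
noncomputable def awayEquiv {a : A} (ha : a ≠ 0) :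
    Localization.Away a ≃ₐ[k] awaySubalgebra k K ha :=
  (IsLocalization.algEquiv (Submonoid.powers a) (Localization.Away a)
    (Localization.subalgebra.ofField K (Submonoid.powers a)
      (powers_le_nonZeroDivisors_of_noZeroDivisors ha))).restrictScalars k

theorem exists_ne_zero_forall_range_le [Algebra.FiniteType k B] : ∃ d : A, d ≠ 0 ∧
    ∀ L : Subalgebra k K, (IsScalarTower.toAlgHom k A K).range ≤ L → (algebraMap A K d)⁻¹ ∈ L →
      (IsScalarTower.toAlgHom k B K).range ≤ L := by
  classical
  obtain ⟨S, hS⟩ := Algebra.FiniteType.out (R := k) (A := B)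
  obtain ⟨d, hd⟩ := IsLocalization.exist_integer_multiples_of_finset (nonZeroDivisors A)
    (S.image (algebraMap B K))
  have hd0 : algebraMap A K d ≠ 0 := IsFractionRing.to_map_ne_zero_of_mem_nonZeroDivisors d.2
  refine ⟨d, nonZeroDivisors.ne_zero d.2, fun L hA hdL => ?_⟩
  rw [← Algebra.map_top, ← hS, AlgHom.map_adjoin, Algebra.adjoin_le_iff]
  rintro _ ⟨x, hx, rfl⟩
  obtain ⟨a, ha⟩ := hd _ (Finset.mem_image_of_mem _ hx)
  rw [Algebra.smul_def] at ha
  rw [SetLike.mem_coe, IsScalarTower.coe_toAlgHom', ← inv_mul_cancel_left₀ hd0 (algebraMap B K x),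
    ← ha]
  exact L.mul_mem hdL (hA ⟨a, rfl⟩)

theorem inv_mem_and_inv_mul_mem {L : Subalgebra k K} {d a b c : K} {m n : ℕ} (hd : d ∈ L)
    (ha : a ∈ L) (hd0 : d ≠ 0) (ha0 : a ≠ 0) (hb : b = a * (d ^ m)⁻¹) (hc : d = c * (b ^ n)⁻¹)
    (h : (d * a)⁻¹ ∈ L) : d⁻¹ ∈ L ∧ (b * c)⁻¹ ∈ L := by
  have hb0 : b ≠ 0 := hb ▸ mul_ne_zero ha0 (inv_ne_zero (pow_ne_zero m hd0))
  have hdL : d⁻¹ ∈ L := by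
    rw [show d⁻¹ = a * (d * a)⁻¹ by field_simp]
    exact L.mul_mem ha h
  have hbL : b⁻¹ ∈ L := by
    rw [show b⁻¹ = d ^ m * d * (d * a)⁻¹ by rw [hb]; field_simp]
    exact L.mul_mem (L.mul_mem (L.pow_mem hd m) hd) h
  refine ⟨hdL, ?_⟩
  rw [show (b * c)⁻¹ = b⁻¹ * (d⁻¹ * b⁻¹ ^ n) by simp only [hc, inv_pow]; field_simp]
  exact L.mul_mem hbL (L.mul_mem hdL (L.pow_mem hbL n))

theorem exists_nonempty_away_algEquiv_away (k A B K : Type*) [Field k] [Field K] [Algebra k K]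
    [CommRing A] [IsDomain A] [Algebra k A] [Algebra.FiniteType k A]
    [Algebra A K] [IsScalarTower k A K] [IsFractionRing A K]
    [CommRing B] [IsDomain B] [Algebra k B] [Algebra.FiniteType k B]
    [Algebra B K] [IsScalarTower k B K] [IsFractionRing B K] : ∃ (a : A) (b : B), a ≠ 0 ∧ b ≠ 0 ∧
      Nonempty (Localization.Away a ≃ₐ[k] Localization.Away b) := by
  obtain ⟨d, hd, hB⟩ := exists_ne_zero_forall_range_le (k := k) (A := A) (B := B) (K := K)
  obtain ⟨b, hb, hA⟩ := exists_ne_zero_forall_range_le (k := k) (A := B) (B := A) (K := K)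
  have hdK : algebraMap A K d ≠ 0 := by simpa
  have hbK : algebraMap B K b ≠ 0 := by simpa
  obtain ⟨a, m, ha⟩ : ∃ a m, algebraMap B K b = algebraMap A K a * (algebraMap A K d ^ m)⁻¹ :=
    mem_awaySubalgebra.1 <|
      hB _ (range_le_awaySubalgebra hd) (inv_mem_awaySubalgebra hd) ⟨b, rfl⟩
  obtain ⟨c, n, hc⟩ : ∃ c n, algebraMap A K d = algebraMap B K c * (algebraMap B K b ^ n)⁻¹ :=
    mem_awaySubalgebra.1 <|
      hA _ (range_le_awaySubalgebra hb) (inv_mem_awaySubalgebra hb) ⟨d, rfl⟩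
  have haK : algebraMap A K a ≠ 0 := left_ne_zero_of_mul (ha ▸ hbK)
  have hcK : algebraMap B K c ≠ 0 := left_ne_zero_of_mul (hc ▸ hdK)
  have hda : d * a ≠ 0 := mul_ne_zero hd (ne_zero_of_map haK)
  have hbc : b * c ≠ 0 := mul_ne_zero hb (ne_zero_of_map hcK)
  refine ⟨d * a, b * c, hda, hbc, ⟨(awayEquiv hda).trans
    ((Subalgebra.equivOfEq _ _ (le_antisymm ?_ ?_)).trans (awayEquiv (K := K) hbc).symm)⟩⟩
  · have hBL := range_le_awaySubalgebra (k := k) (K := K) hbc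
    obtain ⟨hbL, hdaL⟩ := inv_mem_and_inv_mul_mem (hBL ⟨b, rfl⟩) (hBL ⟨c, rfl⟩) hbK hcK hc ha
      (by simpa using inv_mem_awaySubalgebra (k := k) (K := K) hbc)
    exact awaySubalgebra_le (hA _ hBL hbL) (by simpa using hdaL)
  · have hAL := range_le_awaySubalgebra (k := k) (K := K) hda
    obtain ⟨hdL, hbcL⟩ := inv_mem_and_inv_mul_mem (hAL ⟨d, rfl⟩) (hAL ⟨a, rfl⟩) hdK haK ha hc
      (by simpa using inv_mem_awaySubalgebra (k := k) (K := K) hda)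
    exact awaySubalgebra_le (hB _ hAL hdL) (by simpa using hbcL)

end Birational

/-- A birational chart of `Spec A`: an isomorphism of a nonempty basic open subset with a nonempty
basic open subset of the affine space with coordinates indexed by `σ`. -/
structure RationalChart (k A σ : Type*) [Field k] [CommRing A] [Algebra k A] where
  fn : A
  fn_ne_zero : fn ≠ 0
  poly : MvPolynomial σ k
  poly_ne_zero : poly ≠ 0
  equiv : Localization.Away fn ≃ₐ[k] Localization.Away poly

theorem exists_nonempty_rationalChart {k A : Type*} [Field k] [CommRing A] [Algebra k A]
    [Algebra.FiniteType k A] (h : IsRationalVariety k A) :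
    ∃ n : ℕ, Nonempty (RationalChart k A (Fin n)) := by
  obtain ⟨_, n, ⟨e⟩⟩ := h
  let φ : A →ₐ[k] FractionRing (MvPolynomial (Fin n) k) :=
    e.toAlgHom.comp (IsScalarTower.toAlgHom k A (FractionRing A))
  let _ := φ.toAlgebra
  have : IsScalarTower k A (FractionRing (MvPolynomial (Fin n) k)) := .of_algHom φ
  have : IsFractionRing A (FractionRing (MvPolynomial (Fin n) k)) :=
    IsLocalization.isLocalization_of_algEquiv _
      (AlgEquiv.ofRingEquiv (f := e.toRingEquiv) fun _ => rfl)
  obtain ⟨a, p, ha, hp, ⟨ψ⟩⟩ := exists_nonempty_away_algEquiv_away k A (MvPolynomial (Fin n) k)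
    (FractionRing (MvPolynomial (Fin n) k))
  exact ⟨n, ⟨a, ha, p, hp, ψ⟩⟩

namespace RationalChart

variable {k A σ : Type*} [Field k] [CommRing A] [Algebra k A] (C : RationalChart k A σ)
  {E : Type*} [Field E] [Algebra k E]

/-- The `E`-points of the domain of the chart. -/
abbrev Point (E : Type*) [Field E] [Algebra k E] : Type _ :=
  Localization.Away C.fn →ₐ[k] E

/-- The inclusion of the domain of the chart into `Spec A`, on `E`-points. -/
noncomputable def toSpec (P : C.Point E) : A →ₐ[k] E :=
  P.comp (IsScalarTower.toAlgHom k A _)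

/-- The coordinates of an `E`-point of the domain of the chart. -/
noncomputable def coords (P : C.Point E) (i : σ) : E :=
  P (C.equiv.symm (algebraMap (MvPolynomial σ k) _ (X i)))

theorem toSpec_fn_ne_zero (P : C.Point E) : C.toSpec P C.fn ≠ 0 :=
  ((IsLocalization.Away.algebraMap_isUnit C.fn).map P).ne_zero

theorem exists_toSpec_eq {g : A →ₐ[k] E} (hg : g C.fn ≠ 0) : ∃ P, C.toSpec P = g :=
  ⟨IsLocalization.Away.liftAlgHom C.fn (f := g) hg.isUnit,
    AlgHom.ext (IsLocalization.Away.lift_eq C.fn hg.isUnit)⟩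

theorem aeval_coords (P : C.Point E) : aeval (C.coords P) =
    (P.comp C.equiv.symm.toAlgHom).comp (IsScalarTower.toAlgHom k (MvPolynomial σ k) _) :=
  algHom_ext fun i => by simp [coords]

theorem aeval_coords_poly_ne_zero (P : C.Point E) : aeval (C.coords P) C.poly ≠ 0 := by
  rw [aeval_coords]
  exact ((IsLocalization.Away.algebraMap_isUnit C.poly).map (P.comp C.equiv.symm.toAlgHom)).ne_zero

theorem coords_injective : Function.Injective (C.coords (E := E)) := by
  intro P Q h
  have := congrArg (aeval (R := k)) h
  rw [aeval_coords, aeval_coords] at this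
  have := IsLocalization.algHom_ext (.powers C.poly) this
  exact AlgHom.ext fun x => by simpa using DFunLike.congr_fun this (C.equiv x)

theorem exists_coords_eq {x : σ → E} (hx : aeval x C.poly ≠ 0) : ∃ P, C.coords P = x :=
  ⟨(IsLocalization.Away.liftAlgHom C.poly (f := aeval x) hx.isUnit).comp C.equiv.toAlgHom,
    funext fun i => by simp [coords]⟩

theorem exists_toSpec_apply_ne_zero [Infinite k] [IsDomain A] {a : A} (ha : a ≠ 0) :
    ∃ P : C.Point k, C.toSpec P a ≠ 0 := by
  have ha' : C.equiv (algebraMap A _ a) ≠ 0 := by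
    rw [Ne, EmbeddingLike.map_eq_zero_iff]
    exact (map_ne_zero_iff _ (IsLocalization.injective _
      (powers_le_nonZeroDivisors_of_noZeroDivisors C.fn_ne_zero))).2 ha
  obtain ⟨n, p, hp⟩ := IsLocalization.Away.surj C.poly (C.equiv (algebraMap A _ a))
  have hp0 : p ≠ 0 := by
    rintro rfl
    rw [map_zero, ((IsLocalization.Away.algebraMap_isUnit C.poly).pow n).mul_left_eq_zero] at hp
    exact ha' hp
  obtain ⟨x, hx⟩ : ∃ x : σ → k, aeval x (C.poly * p) ≠ 0 := by
    by_contra! h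
    exact mul_ne_zero C.poly_ne_zero hp0 (MvPolynomial.funext fun x => by simpa using h x)
  rw [map_mul] at hx
  obtain ⟨P, rfl⟩ := C.exists_coords_eq (left_ne_zero_of_mul hx)
  refine ⟨P, fun h => right_ne_zero_of_mul hx ?_⟩
  rw [aeval_coords, AlgHom.comp_apply, IsScalarTower.coe_toAlgHom', ← hp, map_mul]
  simp [show P (algebraMap A _ a) = 0 from h]

theorem exists_comp_eq_of_coords_mem {L : IntermediateField k E} {P : C.Point E}
    (h : ∀ i, C.coords P i ∈ L) : ∃ Q : C.Point L, L.val.comp Q = P := by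
  let x (i : σ) : L := ⟨C.coords P i, h i⟩
  have hx : L.val (aeval x C.poly) ≠ 0 := by
    rw [comp_aeval_apply]
    exact C.aeval_coords_poly_ne_zero P
  obtain ⟨Q, hQ⟩ := C.exists_coords_eq (ne_zero_of_map hx)
  refine ⟨Q, C.coords_injective (funext fun i => ?_)⟩
  exact congrArg L.val (congrFun hQ i)

section Specialization

variable {τ : Type*} {c : τ → E}

theorem specializesAt_of_toSpec {P : C.Point (FractionRing (MvPolynomial τ E))} {Q : C.Point E}
    (h : SpecializesAt c (C.toSpec P) (C.toSpec Q)) : SpecializesAt c P Q :=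
  .of_isLocalization (.powers C.fn) h

theorem specializesAt_of_coords {P : C.Point (FractionRing (MvPolynomial τ E))} {Q : C.Point E}
    (h : ∀ i, HasValueAt (C.coords P i) c (C.coords Q i)) : SpecializesAt c P Q := by
  have : SpecializesAt c (P.comp C.equiv.symm.toAlgHom) (Q.comp C.equiv.symm.toAlgHom) := by
    refine .of_isLocalization (.powers C.poly) ?_
    rw [← aeval_coords, ← aeval_coords]
    exact .of_mvPolynomial (by simpa using h)
  intro b
  simpa using this (C.equiv b)

theorem exists_eventually_specializesAt (p : σ → MvPolynomial τ E)
    (hp : aeval (fun i => eval c (p i)) C.poly ≠ 0) :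
    ∃ P : C.Point (FractionRing (MvPolynomial τ E)), ∀ᶠ x in zariskiNhds c,
      ∃ Q : C.Point E, (C.coords Q = fun i => eval x (p i)) ∧ SpecializesAt x P Q := by
  let ξ (i : σ) : FractionRing (MvPolynomial τ E) := algebraMap _ _ (p i)
  have hξ (x : τ → E) : SpecializesAt x (aeval ξ) (aeval (R := k) fun i => eval x (p i)) :=
    .of_mvPolynomial fun i => by simpa using HasValueAt.polynomial (p i) x
  obtain ⟨P, hP⟩ := C.exists_coords_eq ((hξ c C.poly).ne_zero hp)
  refine ⟨P, ((hξ c C.poly).eventually_ne_zero hp).mono ?_⟩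
  rintro x ⟨z, hz, hxz⟩
  obtain ⟨Q, hQ⟩ := C.exists_coords_eq ((hξ x C.poly).unique hxz ▸ hz)
  exact ⟨Q, hQ, C.specializesAt_of_coords fun i => by
    simpa [hP, hQ, ξ] using HasValueAt.polynomial (p i) x⟩

theorem exists_eventually_hasValueAt_coords {Γ : A →ₐ[k] FractionRing (MvPolynomial τ E)}
    {P : C.Point E} (hΓ : SpecializesAt c Γ (C.toSpec P)) :
    ∃ φ : σ → FractionRing (MvPolynomial τ E), ∀ᶠ x in zariskiNhds c, ∀ g, SpecializesAt x Γ g →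
      ∃ Q : C.Point E, C.toSpec Q = g ∧ ∀ i, HasValueAt (φ i) x (C.coords Q i) := by
  have hfn := hΓ C.fn
  obtain ⟨P', rfl⟩ := C.exists_toSpec_eq (hfn.ne_zero (C.toSpec_fn_ne_zero P))
  refine ⟨C.coords P', (hfn.eventually_ne_zero (C.toSpec_fn_ne_zero P)).mono ?_⟩
  rintro x ⟨z, hz, hxz⟩ g hg
  obtain ⟨Q, rfl⟩ := C.exists_toSpec_eq ((hg C.fn).unique hxz ▸ hz)
  exact ⟨Q, rfl, fun i => C.specializesAt_of_toSpec hg _⟩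

end Specialization

end RationalChart

section SlicingTensors

open TensorProduct

theorem exists_linearMap_rTensor_ne_zero {k M N : Type*} [CommRing k] [AddCommGroup M]
    [Module k M] [Module.Free k M] [AddCommGroup N] [Module k N] {z : M ⊗[k] N} (hz : z ≠ 0) :
    ∃ l : M →ₗ[k] k, TensorProduct.lid k N (l.rTensor N z) ≠ 0 := by
  classical
  let b := Module.Free.chooseBasis k M
  obtain ⟨i, hi⟩ := DFunLike.ne_iff.1 ((map_ne_zero_iff _
    (TensorProduct.equivFinsuppOfBasisLeft (N := N) b).injective).2 hz)
  exact ⟨b.coord i, by rwa [← TensorProduct.equivFinsuppOfBasisLeft_apply]⟩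

theorem linearMap_lift_comp_ofId {k A B : Type*} [CommRing k] [CommRing A] [Algebra k A]
    [CommRing B] [Algebra k B] (l : B →ₗ[k] k) (P : A →ₐ[k] k) (z : B ⊗[k] A) :
    l (Algebra.TensorProduct.lift (.id k B) ((Algebra.ofId k B).comp P) (fun _ _ => .all _ _) z) =
      P (TensorProduct.lid k A (l.rTensor A z)) := by
  induction z with
  | zero => simp only [map_zero]
  | add x y hx hy => simp only [map_add, hx, hy]
  | tmul x a =>
    simp [Algebra.ofId_apply, mul_comm x, ← Algebra.smul_def, mul_comm (l x)]

end SlicingTensors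

section GroupStructure

open WithConv TensorProduct

section Points

variable {k A B B' : Type*} [CommRing k] [CommRing A] [HopfAlgebra k A]
  [CommRing B] [Algebra k B] [CommRing B'] [Algebra k B']

/-- The homomorphism `G(B) → G(B')` induced by a homomorphism `B → B'` of `k`-algebras. -/
noncomputable def pointsMap (φ : B →ₐ[k] B') : WithConv (A →ₐ[k] B) →* WithConv (A →ₐ[k] B') where
  toFun g := toConv (φ.comp g.ofConv)
  map_one' := WithConv.ext (AlgHom.ext fun a => φ.commutes (Coalgebra.counit a))
  map_mul' g h := WithConv.ext (AlgHom.comp_convMul_distrib φ g h)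

theorem pointsMap_antipode_mul (g : WithConv (A →ₐ[k] B)) :
    pointsMap g.ofConv (toConv (HopfAlgebra.antipodeAlgHom k A)) * g = 1 := by
  have h := congrArg (pointsMap g.ofConv) (AlgHom.antipode_id_cancel (R := k) (A := A))
  rwa [map_mul, map_one] at h

/-- The group `G(B)` of points of `G = Spec A` with values in a `k`-algebra `B`, extending the
convolution monoid. It is not a global instance, as `AlgHom.convGroup` is one for bialgebras `B`. -/
noncomputable abbrev pointsGroup : Group (WithConv (A →ₐ[k] B)) where
  inv g := pointsMap g.ofConv (toConv (HopfAlgebra.antipodeAlgHom k A))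
  inv_mul_cancel := pointsMap_antipode_mul

end Points

attribute [local instance] pointsGroup

variable {k A B E : Type*} [Field k] [CommRing A] [HopfAlgebra k A] [CommRing B] [Algebra k B]
  [Field E] [Algebra k E]

theorem translate_generic_ne_zero [Nontrivial B] (γ : WithConv (A →ₐ[k] B)) {d : A} (hd : d ≠ 0) :
    (pointsMap (Algebra.TensorProduct.includeLeft : B →ₐ[k] B ⊗[k] A) γ *
      toConv Algebra.TensorProduct.includeRight).ofConv d ≠ 0 := by
  set γ' := pointsMap (Algebra.TensorProduct.includeLeft : B →ₐ[k] B ⊗[k] A) γ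
  let ι : A →ₐ[k] B ⊗[k] A := Algebra.TensorProduct.includeRight
  let L : B ⊗[k] A →ₐ[k] B ⊗[k] A := Algebra.TensorProduct.lift
    Algebra.TensorProduct.includeLeft (γ'⁻¹ * toConv ι).ofConv fun _ _ => Commute.all _ _
  have hγ : pointsMap L γ' = γ' := WithConv.ext (AlgHom.ext fun a => by simp [γ', pointsMap, L])
  have hι : pointsMap L (toConv ι) = γ'⁻¹ * toConv ι :=
    WithConv.ext (AlgHom.ext fun a => by simp [pointsMap, L, ι])
  have hL : pointsMap L (γ' * toConv ι) = toConv ι := by rw [map_mul, hγ, hι, mul_inv_cancel_left]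
  intro h
  have hd' : ι d = 0 :=
    (congrArg (fun g => g.ofConv d) hL.symm).trans ((congrArg L h).trans (map_zero L))
  exact hd (Algebra.TensorProduct.includeRight_injective (FaithfulSMul.algebraMap_injective k B)
    (hd'.trans (map_zero ι).symm))

/-- The point of the group scheme `Spec A` given by a point of the chart. -/
noncomputable abbrev RationalChart.toGroup {σ : Type*} (C : RationalChart k A σ) (P : C.Point E) :
    GroupPoints k A E :=
  toConv (C.toSpec P)

theorem RationalChart.exists_translate_apply_ne_zero [Infinite k] [IsDomain A] {σ : Type*}
    (C : RationalChart k A σ) (γ : GroupPoints k A E) {d : A} (hd : d ≠ 0) :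
    ∃ P : C.Point k, (γ * C.toGroup ((Algebra.ofId k E).comp P)).ofConv d ≠ 0 := by
  obtain ⟨l, hl⟩ := exists_linearMap_rTensor_ne_zero (translate_generic_ne_zero γ hd)
  obtain ⟨P, hP⟩ := C.exists_toSpec_apply_ne_zero hl
  rw [← linearMap_lift_comp_ofId] at hP
  set s : E ⊗[k] A →ₐ[k] E := Algebra.TensorProduct.lift (AlgHom.id k E)
    ((Algebra.ofId k E).comp (C.toSpec P)) fun _ _ => .all _ _
  have hs : pointsMap s (pointsMap (Algebra.TensorProduct.includeLeft : E →ₐ[k] E ⊗[k] A) γ *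
      toConv Algebra.TensorProduct.includeRight) =
        γ * C.toGroup ((Algebra.ofId k E).comp P) := by
    rw [map_mul]
    congr 1 <;>
      exact WithConv.ext (AlgHom.ext fun a => by simp [pointsMap, RationalChart.toSpec, s])
  refine ⟨P, ?_⟩
  rw [← hs]
  exact ne_zero_of_map hP

end GroupStructure

namespace RationalChart

section Factorization

open WithConv

attribute [local instance] pointsGroup

variable {k A σ : Type*} [Field k] [CommRing A] [HopfAlgebra k A] (C : RationalChart k A σ)
  {E : Type*} [Field E] [Algebra k E]

theorem toGroup_injective : Function.Injective (C.toGroup (E := E)) := fun _ _ h =>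
  IsLocalization.algHom_ext (.powers C.fn) (toConv_injective h)

theorem exists_eventually_hasValueAt_mul_mul {τ : Type*} {c : τ → E} (p q : σ → MvPolynomial τ E)
    {γ : GroupPoints k A E} {P₀ Q₀ R₀ : C.Point E} (hP : C.coords P₀ = fun i => eval c (p i))
    (hQ : C.coords Q₀ = fun i => eval c (q i))
    (hR : C.toGroup P₀ * γ * C.toGroup Q₀ = C.toGroup R₀) :
    ∃ φ : σ → FractionRing (MvPolynomial τ E), ∀ᶠ x in zariskiNhds c, ∃ P Q R : C.Point E,
      (C.coords P = fun i => eval x (p i)) ∧ (C.coords Q = fun i => eval x (q i)) ∧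
      C.toGroup P * γ * C.toGroup Q = C.toGroup R ∧ ∀ i, HasValueAt (φ i) x (C.coords R i) := by
  obtain ⟨P', hP'⟩ := C.exists_eventually_specializesAt p (hP ▸ C.aeval_coords_poly_ne_zero P₀)
  obtain ⟨Q', hQ'⟩ := C.exists_eventually_specializesAt q (hQ ▸ C.aeval_coords_poly_ne_zero Q₀)
  let Γ : GroupPoints k A (FractionRing (MvPolynomial τ E)) :=
    toConv (C.toSpec P') * toConv ((IsScalarTower.toAlgHom k E _).comp γ.ofConv) *
      toConv (C.toSpec Q')
  have hΓ {x : τ → E} {P Q : C.Point E} (hP : SpecializesAt x P' P) (hQ : SpecializesAt x Q' Q) :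
      SpecializesAt x Γ.ofConv (C.toGroup P * γ * C.toGroup Q).ofConv :=
    .convMul (.convMul (fun a => hP (algebraMap A _ a)) (.const γ.ofConv x))
      fun a => hQ (algebraMap A _ a)
  have hΓc : SpecializesAt c Γ.ofConv (C.toSpec R₀) := by
    obtain ⟨⟨P₁, hP₁, hPc⟩, Q₁, hQ₁, hQc⟩ := self_of_zariskiNhds (hP'.and hQ')
    rw [C.coords_injective (hP₁.trans hP.symm)] at hPc
    rw [C.coords_injective (hQ₁.trans hQ.symm)] at hQc
    simpa only [hR] using hΓ hPc hQc
  obtain ⟨φ, hφ⟩ := C.exists_eventually_hasValueAt_coords hΓc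
  refine ⟨φ, (hφ.and (hP'.and hQ')).mono ?_⟩
  rintro x ⟨hx, ⟨P, hPx, hP⟩, Q, hQx, hQ⟩
  obtain ⟨R, hR, hRφ⟩ := hx _ (hΓ hP hQ)
  exact ⟨P, Q, R, hPx, hQx, congrArg toConv hR.symm, hRφ⟩

theorem exists_eventually_hasValueAt_mul_inv_mul (H : C.Point E) :
    ∃ φ : σ → FractionRing (MvPolynomial (σ ⊕ σ) E),
      (∀ᶠ c in zariskiNhds 0, c ∘ Sum.inl = 0 ∨ c ∘ Sum.inr = 0 →
        ∀ i, HasValueAt (φ i) c (c (.inl i) + c (.inr i))) ∧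
      ∀ᶠ c in zariskiNhds 0, ∃ P Q R : C.Point E, C.coords P = C.coords H + c ∘ Sum.inl ∧
        C.coords Q = C.coords H + c ∘ Sum.inr ∧
        C.toGroup P * (C.toGroup H)⁻¹ * C.toGroup Q = C.toGroup R ∧
        ∀ i, HasValueAt (φ i) c (C.coords R i - C.coords H i) := by
  obtain ⟨φ, hφ⟩ := C.exists_eventually_hasValueAt_mul_mul (c := (0 : σ ⊕ σ → E))
    (fun i => MvPolynomial.C (C.coords H i) + X (.inl i))
    (fun i => MvPolynomial.C (C.coords H i) + X (.inr i)) (γ := (C.toGroup H)⁻¹) (P₀ := H) (Q₀ := H)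
    (R₀ := H) (by simp) (by simp) (by rw [mul_inv_cancel, one_mul])
  replace hφ : ∀ᶠ c in zariskiNhds 0, ∃ P Q R : C.Point E, C.coords P = C.coords H + c ∘ Sum.inl ∧
      C.coords Q = C.coords H + c ∘ Sum.inr ∧
      C.toGroup P * (C.toGroup H)⁻¹ * C.toGroup Q = C.toGroup R ∧
      ∀ i, HasValueAt (φ i - algebraMap E _ (C.coords H i)) c (C.coords R i - C.coords H i) := by
    refine hφ.mono ?_
    rintro c ⟨P, Q, R, hP, hQ, hPQ, hR⟩
    exact ⟨P, Q, R, hP.trans (funext fun i => by simp), hQ.trans (funext fun i => by simp), hPQ,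
      fun i => (hR i).sub_const _⟩
  refine ⟨_, hφ.mono ?_, hφ⟩
  rintro c ⟨P, Q, R, hP, hQ, hPQ, hR⟩ (hc | hc) i
  · obtain rfl : P = H := C.coords_injective (by rw [hP, hc, add_zero])
    rw [mul_inv_cancel, one_mul] at hPQ
    obtain rfl : Q = R := C.toGroup_injective hPQ
    simpa [hQ, show c (.inl i) = 0 from congrFun hc i] using hR i
  · obtain rfl : Q = H := C.coords_injective (by rw [hQ, hc, add_zero])
    rw [inv_mul_cancel_right] at hPQ
    obtain rfl : P = R := C.toGroup_injective hPQ
    simpa [hP, show c (.inr i) = 0 from congrFun hc i] using hR i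

variable {R₀ F₀ : Type*} [CommRing R₀] [IsDomain R₀] [IsDiscreteValuationRing R₀]
  [Field F₀] [Algebra R₀ F₀] [IsFractionRing R₀ F₀] [Algebra k F₀] [Finite σ]

theorem exists_forall_eq_mul_inv_mul {T : Type*} [CommRing T] [Algebra T R₀] {t : T}
    (ht : Irreducible (algebraMap T R₀ t)) {V W : Submodule T R₀}
    (hV : IsPrecomplete (Ideal.span {t}) V) (hW : IsPrecomplete (Ideal.span {t}) W)
    (hVW : V ⊔ W = ⊤) (H : C.Point F₀) :
    ∃ N : ℕ, ∀ (R : C.Point F₀) (a : σ → R₀),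
      C.coords R = C.coords H + algebraMap R₀ F₀ ∘ (algebraMap T R₀ t ^ N • a) →
      ∃ P Q : C.Point F₀, (∀ i, ∃ v ∈ V, C.coords P i = C.coords H i + algebraMap R₀ F₀ v) ∧
        (∀ i, ∃ w ∈ W, C.coords Q i = C.coords H i + algebraMap R₀ F₀ w) ∧
        C.toGroup P * (C.toGroup H)⁻¹ * C.toGroup Q = C.toGroup R := by
  obtain ⟨φ, hφ, hφH⟩ := C.exists_eventually_hasValueAt_mul_inv_mul H
  obtain ⟨N, hN⟩ := exists_forall_exists_hasValueAt ht hV hW hVW hφ hφH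
  refine ⟨N, fun R a hR => ?_⟩
  obtain ⟨x, hxV, hxW, ⟨P, Q, R', hP, hQ, hPQ, hR'⟩, hxa⟩ := hN a
  obtain rfl : R' = R := C.coords_injective <| funext fun i => by
    simp [hR, ← (hR' i).unique (hxa i)]
  exact ⟨P, Q, fun i => ⟨_, hxV i, congrFun hP i⟩, fun i => ⟨_, hxW i, congrFun hQ i⟩, hPQ⟩

theorem exists_forall_coords_eq_add_of_mul_eq {ϖ : R₀} (hϖ : Irreducible ϖ) {γ : GroupPoints k A F₀}
    {P R : C.Point F₀} (hR : C.toGroup P * γ = C.toGroup R) (N : ℕ) :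
    ∃ M, ∀ x : σ → R₀, ∃ (P' R' : C.Point F₀) (r : σ → R₀),
      C.coords P' = C.coords P + algebraMap R₀ F₀ ∘ (ϖ ^ M • x) ∧
      C.toGroup P' * γ = C.toGroup R' ∧
      C.coords R' = C.coords R + algebraMap R₀ F₀ ∘ (ϖ ^ N • r) := by
  obtain ⟨φ, hφ⟩ := C.exists_eventually_hasValueAt_mul_mul (c := C.coords P) X
    (fun i => MvPolynomial.C (C.coords R i)) (γ := γ * (C.toGroup R)⁻¹) (P₀ := P) (Q₀ := R)
    (R₀ := R) (by simp) (by simp) (by rw [← mul_assoc, inv_mul_cancel_right, hR])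
  have hφ' : ∀ᶠ x in zariskiNhds (C.coords P), ∃ P' R' : C.Point F₀, C.coords P' = x ∧
      C.toGroup P' * γ = C.toGroup R' ∧ ∀ i, HasValueAt (φ i) x (C.coords R' i) := by
    refine hφ.mono ?_
    rintro x ⟨P', Q', R', hP', hQ', h, hR'⟩
    obtain rfl : Q' = R := C.coords_injective (by simpa using hQ')
    rw [← mul_assoc, inv_mul_cancel_right] at h
    exact ⟨P', R', by simpa using hP', h, hR'⟩
  have hφP (i : σ) : HasValueAt (φ i) (C.coords P) (C.coords R i) := by
    obtain ⟨P', R', hP', h, hR'⟩ := self_of_zariskiNhds hφ'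
    obtain rfl := C.coords_injective hP'
    obtain rfl := C.toGroup_injective (hR.symm.trans h)
    exact hR' i
  obtain ⟨M, hφM, hM⟩ := ((eventually_adic_of_zariskiNhds hϖ hφ').and
    (eventually_all.2 fun i => (hφP i).eventually_adic hϖ N)).exists
  refine ⟨M, fun x => ?_⟩
  obtain ⟨P', R', hP', h, hR'⟩ := hφM x
  choose r hr using fun i => hM i x
  exact ⟨P', R', r, hP', h, funext fun i => (hR' i).unique (hr i)⟩

end Factorization

end RationalChart

section SmallVectors

variable {R₀ F₀ : Type*} [CommRing R₀] [IsDomain R₀] [IsDiscreteValuationRing R₀]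
  [Field F₀] [Algebra R₀ F₀] [IsFractionRing R₀ F₀] {α : ℝ}

theorem exists_forall_adicVecNorm_le (hα : 1 < α) {T : Type*} [CommRing T] [Algebra T R₀] {t : T}
    (ht : Irreducible (algebraMap T R₀ t)) {V W : Submodule T R₀}
    (hV : IsPrecomplete (Ideal.span {t}) V) (hW : IsPrecomplete (Ideal.span {t}) W)
    (hVW : V ⊔ W = ⊤) {n : ℕ} {f : Fin n → FractionRing (MvPolynomial (Fin n ⊕ Fin n) F₀)}
    {U : TopologicalSpace.Opens (PrimeSpectrum (MvPolynomial (Fin n ⊕ Fin n) F₀))}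
    (h0 : pointToPoint (Sum.elim (0 : Fin n → F₀) 0) ∈ U)
    (hl : ∀ u : Fin n → F₀, pointToPoint (Sum.elim u 0) ∈ U →
      ∀ i, HasValueAt (f i) (Sum.elim u 0) (u i))
    (hr : ∀ u : Fin n → F₀, pointToPoint (Sum.elim 0 u) ∈ U →
      ∀ i, HasValueAt (f i) (Sum.elim 0 u) (u i)) :
    ∃ ε : ℝ, 0 < ε ∧ ∀ a : Fin n → F₀, adicVecNorm R₀ α a ≤ ε →
      ∃ v w : Fin n → R₀, (∀ i, v i ∈ V) ∧ (∀ i, w i ∈ W) ∧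
        pointToPoint (Sum.elim (algebraMap R₀ F₀ ∘ v) (algebraMap R₀ F₀ ∘ w)) ∈ U ∧
        ∀ i, HasValueAt (f i) (Sum.elim (algebraMap R₀ F₀ ∘ v) (algebraMap R₀ F₀ ∘ w)) (a i) := by
  rw [Sum.elim_zero_zero] at h0
  have hU : ∀ᶠ c in zariskiNhds (0 : Fin n ⊕ Fin n → F₀), pointToPoint c ∈ U :=
    preimage_mem_comap (U.isOpen.mem_nhds h0)
  have hf : ∀ᶠ c in zariskiNhds (0 : Fin n ⊕ Fin n → F₀), c ∘ Sum.inl = 0 ∨ c ∘ Sum.inr = 0 →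
      ∀ i, HasValueAt (f i) c (c (.inl i) + c (.inr i)) := by
    refine hU.mono fun c => ?_
    obtain ⟨u, w, rfl⟩ : ∃ u w, c = Sum.elim u w := ⟨_, _, (Sum.elim_comp_inl_inr c).symm⟩
    rw [Sum.elim_comp_inl, Sum.elim_comp_inr]
    rintro hc (rfl | rfl) i
    · simpa using hr w hc i
    · simpa using hl u hc i
  obtain ⟨N, hN⟩ := exists_forall_exists_hasValueAt ht hV hW hVW hf hU
  refine ⟨α ^ (-(N : ℤ)), by positivity, fun a ha => ?_⟩
  obtain ⟨r, rfl⟩ := exists_eq_pow_smul_of_adicVecNorm_le ht hα ha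
  obtain ⟨x, hxV, hxW, hxU, hx⟩ := hN r
  refine ⟨x ∘ Sum.inl, x ∘ Sum.inr, hxV, hxW, ?_⟩
  rw [← Function.comp_assoc, ← Function.comp_assoc, Sum.elim_comp_inl_inr]
  exact ⟨hxU, hx⟩

theorem IsAdicallyDense.exists_forall_add_pow_mul_mem {ϖ : R₀} (hϖ : Irreducible ϖ) (hα : 1 < α)
    {S : Set F₀} (hS : IsAdicallyDense R₀ α S) (M : ℕ) {τ : Type*} (c : τ → F₀) :
    ∃ x : τ → R₀, ∀ i, (c + algebraMap R₀ F₀ ∘ (ϖ ^ M • x)) i ∈ S := by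
  choose y hyS hy using fun i => hS (c i) (α ^ (-(M : ℤ))) (by positivity)
  choose r hr using fun i => exists_eq_pow_mul_of_adicNorm_le hϖ hα (hy i).le
  refine ⟨-r, fun i => ?_⟩
  convert hyS i
  simp [sub_eq_iff_eq_add.1 (hr i)]

end SmallVectors

section Factorization

attribute [local instance] pointsGroup

variable {k A σ : Type*} [Field k] [CommRing A] [HopfAlgebra k A]

namespace RationalChart

theorem toGroup_mem_range (C : RationalChart k A σ) {E : Type*} [Field E] [Algebra k E]
    {L : IntermediateField k E} {P : C.Point E} (h : ∀ i, C.coords P i ∈ L) :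
    C.toGroup P ∈ (pointsMap (A := A) L.val).range :=
  let ⟨Q, hQ⟩ := C.exists_comp_eq_of_coords_mem h
  ⟨C.toGroup Q, congrArg C.toGroup hQ⟩

theorem toGroup_ofId_comp_mem_range (C : RationalChart k A σ) {E : Type*} [Field E] [Algebra k E]
    (L : IntermediateField k E) (P : C.Point k) :
    C.toGroup ((Algebra.ofId k E).comp P) ∈ (pointsMap (A := A) L.val).range :=
  C.toGroup_mem_range fun i => L.algebraMap_mem (C.coords P i)

theorem exists_map_mul_map_eq [Infinite k] [IsDomain A] [Finite σ] (C : RationalChart k A σ)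
    {R₀ F₀ : Type*} [CommRing R₀]
    [IsDomain R₀] [IsDiscreteValuationRing R₀] [Field F₀] [Algebra R₀ F₀] [IsFractionRing R₀ F₀]
    [Algebra k F₀] {α : ℝ} (hα : 1 < α) {T : Type*} [CommRing T] [Algebra T R₀] {t : T}
    (ht : Irreducible (algebraMap T R₀ t)) {V W : Submodule T R₀}
    (hV : IsPrecomplete (Ideal.span {t}) V) (hW : IsPrecomplete (Ideal.span {t}) W)
    (hVW : V ⊔ W = ⊤) {K₁ K₂ : IntermediateField k F₀} (hVK : ∀ x ∈ V, algebraMap R₀ F₀ x ∈ K₁)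
    (hWK : ∀ x ∈ W, algebraMap R₀ F₀ x ∈ K₂) (hK₁ : IsAdicallyDense R₀ α (K₁ : Set F₀))
    (g : GroupPoints k A F₀) : ∃ (g₁ : GroupPoints k A K₁) (g₂ : GroupPoints k A K₂),
      GroupPoints.map K₁.val g₁ * GroupPoints.map K₂.val g₂ = g := by
  obtain ⟨P₀, -⟩ := C.exists_toSpec_apply_ne_zero one_ne_zero
  set H : C.Point F₀ := (Algebra.ofId k F₀).comp P₀
  obtain ⟨Q₀, hQ₀⟩ := C.exists_translate_apply_ne_zero (C.toGroup H * g⁻¹) C.fn_ne_zero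
  set h := C.toGroup ((Algebra.ofId k F₀).comp Q₀)
  obtain ⟨Y, hY⟩ := C.exists_toSpec_eq hQ₀
  have hYH : C.toGroup Y * (h⁻¹ * g) = C.toGroup H := by
    rw [show C.toGroup Y = C.toGroup H * g⁻¹ * h from congrArg _ hY]
    group
  obtain ⟨N, hN⟩ := C.exists_forall_eq_mul_inv_mul ht hV hW hVW H
  obtain ⟨M, hM⟩ := C.exists_forall_coords_eq_add_of_mul_eq ht hYH N
  obtain ⟨x, hx⟩ := hK₁.exists_forall_add_pow_mul_mem ht hα M (C.coords Y)
  obtain ⟨Y', R, r, hY', hR, hRH⟩ := hM x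
  obtain ⟨P, Q, hP, hQ, hPQ⟩ := hN R r hRH
  have hY₁ : C.toGroup Y' ∈ (pointsMap K₁.val).range := C.toGroup_mem_range (hY' ▸ hx)
  have hP₁ : C.toGroup P ∈ (pointsMap K₁.val).range := C.toGroup_mem_range fun i => by
    obtain ⟨v, hv, h⟩ := hP i
    exact h ▸ add_mem (K₁.algebraMap_mem _) (hVK v hv)
  obtain ⟨g₂, hg₂⟩ : C.toGroup Q ∈ (pointsMap K₂.val).range := C.toGroup_mem_range fun i => by
    obtain ⟨w, hw, h⟩ := hQ i
    exact h ▸ add_mem (K₂.algebraMap_mem _) (hWK w hw)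
  obtain ⟨g₁, hg₁⟩ : h * (C.toGroup Y')⁻¹ * (C.toGroup P * (C.toGroup H)⁻¹) ∈
      (pointsMap K₁.val).range :=
    mul_mem (mul_mem (C.toGroup_ofId_comp_mem_range K₁ Q₀) (inv_mem hY₁))
      (mul_mem hP₁ (inv_mem (C.toGroup_ofId_comp_mem_range K₁ P₀)))
  refine ⟨g₁, g₂, ?_⟩
  change pointsMap K₁.val g₁ * pointsMap K₂.val g₂ = g
  rw [hg₁, hg₂, mul_assoc, hPQ, ← hR]
  group

end RationalChart

end Factorization

theorem infinite_of_algebraMap_mem {R F₀ : Type*} [CommRing R] [IsDomain R] [Field F₀]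
    [Algebra R F₀] [IsFractionRing R F₀] {ϖ : R} (hϖ : Irreducible ϖ) {F : Subfield F₀}
    (h : algebraMap R F₀ ϖ ∈ F) : Infinite F :=
  .of_injective (fun n : ℕ => (⟨algebraMap R F₀ ϖ, h⟩ : F) ^ n) fun m n hmn =>
    pow_injective_of_not_isUnit hϖ.not_isUnit hϖ.ne_zero <|
      IsFractionRing.injective R F₀ <| by simpa using congrArg Subtype.val hmn

theorem theorem3p2_general {R₀ F₀ : Type*} [CommRing R₀] [IsDomain R₀] [IsDiscreteValuationRing R₀]
    [Field F₀] [Algebra R₀ F₀] [IsFractionRing R₀ F₀] (α : ℝ) (hα : 1 < α)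
    {T : Type*} [CommRing T] [Algebra T R₀] (t : T) (ht : Irreducible (algebraMap T R₀ t))
    (V W : Submodule T R₀) (hV : IsPrecomplete (Ideal.span {t}) V)
    (hW : IsPrecomplete (Ideal.span {t}) W) (hVW : V ⊔ W = ⊤) :
    (∀ (n : ℕ) (f : Fin n → FractionRing (MvPolynomial (Fin n ⊕ Fin n) F₀))
      (U : TopologicalSpace.Opens (PrimeSpectrum (MvPolynomial (Fin n ⊕ Fin n) F₀))),
      pointToPoint (Sum.elim (0 : Fin n → F₀) 0) ∈ U →
      (∀ u : Fin n → F₀, pointToPoint (Sum.elim u 0) ∈ U →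
        ∀ i, HasValueAt (f i) (Sum.elim u 0) (u i)) →
      (∀ u : Fin n → F₀, pointToPoint (Sum.elim 0 u) ∈ U →
        ∀ i, HasValueAt (f i) (Sum.elim 0 u) (u i)) →
      ∃ ε : ℝ, 0 < ε ∧ ∀ a : Fin n → F₀, adicVecNorm R₀ α a ≤ ε →
        ∃ v w : Fin n → R₀, (∀ i, v i ∈ V) ∧ (∀ i, w i ∈ W) ∧
          pointToPoint (Sum.elim (algebraMap R₀ F₀ ∘ v) (algebraMap R₀ F₀ ∘ w)) ∈ U ∧
          ∀ i, HasValueAt (f i)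
            (Sum.elim (algebraMap R₀ F₀ ∘ v) (algebraMap R₀ F₀ ∘ w)) (a i)) ∧
    (∀ (k : Type*) [Field k] [Infinite k] [Algebra k F₀] (K₁ K₂ : IntermediateField k F₀),
      (∀ x ∈ V, algebraMap R₀ F₀ x ∈ K₁) → (∀ x ∈ W, algebraMap R₀ F₀ x ∈ K₂) →
      IsAdicallyDense R₀ α (K₁ : Set F₀) →
      ∀ (A : Type*) [CommRing A] [HopfAlgebra k A] [Algebra.FiniteType k A],
        IsRationalVariety k A → ∀ g : GroupPoints k A F₀,
          ∃ (g₁ : GroupPoints k A K₁) (g₂ : GroupPoints k A K₂),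
            GroupPoints.map K₁.val g₁ * GroupPoints.map K₂.val g₂ = g) := by
  refine ⟨fun n f U => exists_forall_adicVecNorm_le hα ht hV hW hVW, ?_⟩
  intro k _ _ _ K₁ K₂ hVK hWK hK₁ A _ _ _ hA
  have := hA.1
  obtain ⟨n, ⟨C⟩⟩ := exists_nonempty_rationalChart hA
  exact C.exists_map_mul_map_eq hα ht hV hW hVW hVK hWK hK₁

theorem theorem3p2 {R₀ F₀ : Type*} [CommRing R₀] [IsDomain R₀] [IsDiscreteValuationRing R₀]
    [Field F₀] [Algebra R₀ F₀] [IsFractionRing R₀ F₀] (α : ℝ) (hα : 1 < α)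
    (T : Subring R₀) (t : T) (F₁ F₂ : Subfield F₀) (V W : Submodule T R₀)
    (hyp : AdditiveDecomposition T t F₁ F₂ V W) :
    -- decomposition of small vectors by rational maps
    (∀ (n : ℕ) (f : Fin n → FractionRing (MvPolynomial (Fin n ⊕ Fin n) F₀))
      (U : TopologicalSpace.Opens (PrimeSpectrum (MvPolynomial (Fin n ⊕ Fin n) F₀))),
      (∀ i, IsRegularOn (f i) U) →
      MvPolynomial.pointToPoint (Sum.elim (0 : Fin n → F₀) 0) ∈ U →
      (∀ u : Fin n → F₀, MvPolynomial.pointToPoint (Sum.elim u 0) ∈ U →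
        ∀ i, HasValueAt (f i) (Sum.elim u 0) (u i)) →
      (∀ u : Fin n → F₀, MvPolynomial.pointToPoint (Sum.elim 0 u) ∈ U →
        ∀ i, HasValueAt (f i) (Sum.elim 0 u) (u i)) →
      ∃ ε : ℝ, 0 < ε ∧ ∀ a : Fin n → F₀, adicVecNorm R₀ α a ≤ ε →
        ∃ v w : Fin n → R₀, (∀ i, v i ∈ V) ∧ (∀ i, w i ∈ W) ∧
          MvPolynomial.pointToPoint
            (Sum.elim (algebraMap R₀ F₀ ∘ v) (algebraMap R₀ F₀ ∘ w)) ∈ U ∧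
          ∀ i, HasValueAt (f i)
            (Sum.elim (algebraMap R₀ F₀ ∘ v) (algebraMap R₀ F₀ ∘ w)) (a i)) ∧
    -- factorization in rational connected linear algebraic groups
    (∀ (F : Subfield F₀) (hF₁ : F ≤ F₁) (hF₂ : F ≤ F₂),
      (∀ x ∈ T, algebraMap R₀ F₀ x ∈ F) →
      IsAdicallyDense R₀ α (F₁ : Set F₀) →
      ∀ (A : Type*) [CommRing A] [HopfAlgebra F A], IsRationalConnectedGroup F A →
      ∀ g : GroupPoints F A F₀,
        ∃ (g₁ : GroupPoints F A (Subfield.extendScalars hF₁))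
          (g₂ : GroupPoints F A (Subfield.extendScalars hF₂)),
          GroupPoints.map (Subfield.extendScalars hF₁).val g₁ *
            GroupPoints.map (Subfield.extendScalars hF₂).val g₂ = g) := by
  refine (theorem3p2_general α hα t hyp.irreducible_R₀ V W hyp.complete_V.toIsPrecomplete
    hyp.complete_W.toIsPrecomplete hyp.sup_eq_top).imp (fun h n f U _ => h n f U)
    fun h F hF₁ hF₂ hT hdense A _ _ hA => ?_
  have := hA.finiteType
  have : Infinite F := infinite_of_algebraMap_mem hyp.irreducible_R₀ (hT t t.2)
  exact h F (Subfield.extendScalars hF₁) (Subfield.extendScalars hF₂) hyp.V_le_F₁ hyp.W_le_F₂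
    hdense A hA.rational
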